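/- **Setting.** Two parties, Alice and Bob, share copies of a two-qubit pure state $|\psi\rangle\in\mathbb C^2\otimes\mathbb C^2$, with entanglement $E=E(\psi)$, the von Neumann entropy (to base 2) of the reduced state of one party. A *streaming protocol* for one party is a machine with a quantum memory, a one-qubit input/output cell and a write-only output tape. The machine reads the input qubits one at a time into the cell. After each reading it executes a finite program that depends only on the number $n$ of qubits read before. The instructions are unitary gates on the memory and the cell, and emissions, controlled by a computational basis value of the memory, which move the qubit in the cell to the end of the output tape and put a fresh $|0\rangle$ into the cell. There are no measurements and no communication, and emitted qubits are never touched again. Alice and Bob each run the same protocol on their own halves of $|\psi\rangle^{\otimes N}$. The output after $N$ inputs is said to consist of *perfect EPR pairs* if the joint state is $\sum_\ell|\chi_\ell\rangle\otimes|\Phi^+\rangle^{\otimes \ell}$ with both cells in the state $|0\rangle$, where $\chi_\ell$ is an unnormalized state of the two memories, and the factor $|\Phi^+\rangle^{\otimes\ell}$, with $|\Phi^+\rangle=(|00\rangle+|11\rangle)/\sqrt2$, is held by the output tapes, which have length $\ell$ on this branch. The expected yield is then $Y_\psi(N)=\sum_\ell \ell\,\|\chi_\ell\|^2$. **Theorem.**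 There is one streaming protocol, independent of $\psi$, with the following properties. 1. (Reversibility.) For every $N$, it acts on $N$ input qubits as an isometry. After each input it leaves the cell in the state $|0\rangle$, and after $N$ inputs at most $N$ qubits have been emitted on every branch. 2. (Structure.) It interleaves the Clebsch–Gordan transform with the quantum streaming Elias transform. After $n$ inputs its memory holds registers $t$ (a Young diagram with rows $n-t\ge t$), $u\in\{0,\dots,n-2t\}$ (a basis state of the corresponding irrep of $SU(2)$) and $l$ (the number of emitted qubits, which is the position of a 1 in the binary expansion of the dimension $d(n,t)$ of the corresponding irrep of the symmetric group $S_n$). All registers are $0$ at the start. On reading a qubit, the Clebsch–Gordan transform maps $t$, $u$ and the qubit to new $t$, $u$ and a qubit $p$, which tells whether a box is added to the second row. Then, conditional on the new $t$, the following algorithm is applied coherently. If the $l$-th bit of $d(n+1,t)$ is $0$ or the $l$-th bit of the dimension of the other predecessor of $(n+1,t)$ in Young's lattice is $1$, emit $p$ and increase $l$ by 1, and then, while the $l$-th bits of $d(n,t)$ and $d(n,t-1)$ differ, emit the $l$-th bit of $d(n,t)$ and increase $l$ by 1. (Here $d$ is $0$ if there is no such diagram.) 3. (Memory.) While it processes the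 first $N$ inputs, it uses $O(\log N)$ qubits of memory. 4. (Yield, for all input states and all $N$.) There is a constant $C$ such that for every two-qubit pure state $\psi$ and every $N\ge 0$ the output after $N$ inputs consists of perfect EPR pairs, and $$N E(\psi)-C\log(N+1)\;\le\; Y_\psi(N)\;\le\; N E(\psi).$$ 5. (Lag.) For every $\psi$ there is a constant $K$ such that for every $N\ge0$ there is an integer $0\le k\le K\log(N+1)$ with $Y_\psi(N+k)\ge N E(\psi)$. That is, the yield is at most $O(\log N)$ inputs behind the ideal yield $NE$. -/

import Mathlib

open Filter Asymptotics

noncomputable section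

namespace Concentration

/-! ### One party's quantum machine -/

/-- A computational basis configuration of one party's machine: the basis label `mem` of its
memory (bit `i` of the number `mem` is the value of memory qubit `i`, so that a memory of `q` qubits
has the labels `0, …, 2 ^ q - 1`, and all further qubits are in the state `|0⟩`), the value of a
one-qubit input/output cell, and the contents of the output tape (oldest qubit first). -/
structure Conf where
  mem : ℕ
  cell : Bool
  out : List Bool

/-- State vectors of one party: finite superpositions of basis configurations. -/
abbrev State := Conf →₀ ℂ

/-- The elementary instructions of a machine with `q` memory qubits: a unitary gate on the memory
and the cell, or an emission, controlled by the basis label of the memory. -/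
inductive Instr (q : ℕ) where
  | gate (U : Matrix.unitaryGroup (Fin (2 ^ q) × Bool) ℂ)
  | emit (ctrl : Fin (2 ^ q) → Bool)

/-- A gate never touches the tape. An emission moves, on the branches selected by the control, the
qubit in the cell to the end of the output tape, and a fresh `|0⟩` into the cell. There are no
measurements, and qubits that have been emitted are never touched again. -/
def Instr.onBasis {q : ℕ} : Instr q → Conf → State
  | .gate U, x =>
      if h : x.mem < 2 ^ q then
        ∑ y : Fin (2 ^ q) × Bool,
          Finsupp.single ⟨y.1, y.2, x.out⟩
            ((U : Matrix (Fin (2 ^ q) × Bool) (Fin (2 ^ q) × Bool) ℂ) y (⟨x.mem, h⟩, x.cell))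
      else Finsupp.single x 1
  | .emit ctrl, x =>
      if h : x.mem < 2 ^ q then
        if ctrl ⟨x.mem, h⟩ = true then Finsupp.single ⟨x.mem, false, x.out ++ [x.cell]⟩ 1
        else Finsupp.single x 1
      else Finsupp.single x 1

/-- The linear (coherent) action of an instruction. -/
def Instr.act {q : ℕ} (i : Instr q) : State →ₗ[ℂ] State :=
  Finsupp.linearCombination ℂ i.onBasis

/-- Reading an input qubit in the basis state `b`: it takes the place of the qubit in the cell.
(This is used only when the latter is in the state `|0⟩`, see `IsReversible`.) -/
def read (b : Bool) : State →ₗ[ℂ] State :=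
  Finsupp.linearCombination ℂ fun x => Finsupp.single ⟨x.mem, b, x.out⟩ 1

/-- A streaming protocol for one party: to handle the input qubit that follows the first `n` ones,
the machine reads it and executes the finite list `program n` of instructions, which act
on a memory of `qubits n` qubits and the cell. -/
structure StreamingProtocol where
  qubits : ℕ → ℕ
  mono : Monotone qubits
  program : (n : ℕ) → List (Instr (qubits n))

namespace StreamingProtocol

variable (P : StreamingProtocol)

/-- The number of qubits, memory and cell, held by the machine while it handles the first `N + 1`
inputs. -/
def memoryQubits (N : ℕ) : ℕ := P.qubits N + 1

/-- The action of the machine when it reads a qubit in the basis state `b` after `n` earlier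
inputs. -/
def step (n : ℕ) (b : Bool) : State →ₗ[ℂ] State :=
  (P.program n).foldl (fun f i => i.act ∘ₗ f) (read b)

/-- The state of the machine after it has read `N` qubits in the basis state `s`, one at a time,
starting from the all-zero memory, the empty cell and the empty tape. Its linear extension in `s` is
the map that the party applies to `N` input qubits. -/
def run : (N : ℕ) → (Fin N → Bool) → State
  | 0, _ => Finsupp.single ⟨0, false, []⟩ 1
  | N + 1, s => P.step N (s (Fin.last N)) (run N (Fin.init s))

/-- The protocol is reversible: it maps the computational basis of `N` input qubits to orthonormal
states (so it is an isometry, and no information is lost), it returns the cell in the state `|0⟩`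
after each input, and it never uses more fresh `|0⟩` qubits for emissions than it has
returned. -/
def IsReversible : Prop :=
  ∀ N : ℕ,
    (∀ s t : Fin N → Bool,
      ((P.run N s).sum fun x z => star z * P.run N t x) = if s = t then 1 else 0) ∧
    ∀ s : Fin N → Bool, ∀ x ∈ (P.run N s).support, x.cell = false ∧ x.out.length ≤ N

end StreamingProtocol

/-! ### Two parties, entanglement, and EPR pairs -/

/-- Pure states of two qubits (first index: Alice, second index: Bob) live in this space. -/
abbrev TwoQubit := EuclideanSpace ℂ (Bool × Bool)

/-- The coefficient matrix of a two-qubit state. -/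
def coeffMatrix (ψ : TwoQubit) : Matrix Bool Bool ℂ := Matrix.of fun i j => ψ (i, j)

/-- Alice's reduced density matrix. -/
def reducedState (ψ : TwoQubit) : Matrix Bool Bool ℂ :=
  coeffMatrix ψ * (coeffMatrix ψ).conjTranspose

theorem reducedState_isHermitian (ψ : TwoQubit) : (reducedState ψ).IsHermitian :=
  Matrix.isHermitian_mul_conjTranspose_self _

/-- The entanglement of a two-qubit pure state, in ebits: the von Neumann entropy, to base 2, of the
reduced state. -/
def entanglement (ψ : TwoQubit) : ℝ :=
  (∑ i, Real.negMulLog ((reducedState_isHermitian ψ).eigenvalues i)) / Real.log 2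

/-- The tensor product of a state of Alice's machine and a state of Bob's machine. -/
def tensor (f g : State) : Conf × Conf →₀ ℂ :=
  f.sum fun x a => g.sum fun y b => Finsupp.single (x, y) (a * b)

/-- The joint state after Alice and Bob have each run `P`, without communication, on their halves of
`N` copies of `ψ`. -/
def StreamingProtocol.jointState (P : StreamingProtocol) (ψ : TwoQubit) (N : ℕ) :
    Conf × Conf →₀ ℂ :=
  ∑ s : Fin N → Bool, ∑ t : Fin N → Bool,
    (∏ i, ψ (s i, t i)) • tensor (P.run N s) (P.run N t)

/-- The output tapes hold perfect EPR pairs: the joint state is `∑ ℓ, |χ ℓ⟩ ⊗ |Φ⁺⟩^⊗ℓ`, where the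
length of both tapes is `ℓ` on branch `ℓ`, where the `j`-th qubits of the two tapes
form the `j`-th EPR pair `|Φ⁺⟩ = (|00⟩ + |11⟩) / √2`, where `χ ℓ` is an (unnormalized) state
of the two memories, and where the cells are in the state `|0⟩`. -/
def HoldsPerfectEPR (Φ : Conf × Conf →₀ ℂ) : Prop :=
  ∃ χ : ℕ → ℕ → ℕ → ℂ, ∀ x y : Conf,
    Φ (x, y) =
      if x.cell = false ∧ y.cell = false ∧ x.out = y.out then
        χ x.out.length x.mem y.mem * (1 / (Real.sqrt 2 : ℂ)) ^ x.out.length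
      else 0

/-- The expected number of qubits on Alice's output tape; it is the expected number of EPR pairs if
`HoldsPerfectEPR` holds. -/
def expectedYield (Φ : Conf × Conf →₀ ℂ) : ℝ :=
  Φ.sum fun x z => ‖z‖ ^ 2 * (x.1.out.length : ℝ)

/-! ### The Clebsch–Gordan transform and the streaming Elias transform -/

/-- The number of paths from the empty diagram to the Young diagram with rows `n - t` and `t` in
Young's lattice of diagrams with at most two rows, that is, the dimension of the corresponding irrep
of the symmetric group; it is 0 if there is no such diagram. -/
def youngDim : ℕ → ℕ → ℕ
  | 0, 0 => 1
  | 0, _ + 1 => 0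
  | n + 1, 0 => youngDim n 0
  | n + 1, t + 1 => if 2 * (t + 1) ≤ n + 1 then youngDim n (t + 1) + youngDim n t else 0

/-- The size of the node from which `(n + 1, t)` is reached by adding a box to the second row. -/
def youngDimPred (n : ℕ) : ℕ → ℕ
  | 0 => 0
  | t + 1 => youngDim n t

/-- The carry loop of the streaming Elias algorithm for arrival at `(n + 1, t)`: while the `l`-th
bits of the sizes of the two preceding nodes differ, output the bit that belongs to `(n, t)`, and
increase `l`. The result is the final `l` with the list of outputs; the first argument is a bound
for the number of iterations. -/
def eliasCarry (n t : ℕ) : ℕ → ℕ → ℕ × List Bool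
  | 0, l => (l, [])
  | fuel + 1, l =>
      if (youngDim n t).testBit l ≠ (youngDimPred n t).testBit l then
        ((eliasCarry n t fuel (l + 1)).1,
          (youngDim n t).testBit l :: (eliasCarry n t fuel (l + 1)).2)
      else (l, [])

/-- The streaming Elias algorithm on Young's lattice, for a step that arrives at `(n + 1, t)` by
adding a box to the second row if `p` is true and to the first row otherwise, with `l` bits emitted
before: the new number of emitted bits, and the list of bits emitted now. (Both sizes that the loop
uses are less than `2 ^ (n + 1)`, so that `n + 1` iterations are enough.) -/
def eliasStep (n t l : ℕ) (p : Bool) : ℕ × List Bool :=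
  if (youngDim (n + 1) t).testBit l = false ∨
      (if p then youngDim n t else youngDimPred n t).testBit l = true then
    ((eliasCarry n t (n + 1) (l + 1)).1, p :: (eliasCarry n t (n + 1) (l + 1)).2)
  else (l, [])

/-- The Clebsch–Gordan coefficient for coupling the basis state `u ∈ {0, …, j}` (the number of ones)
of the irrep of `SU(2)` of dimension `j + 1` with a qubit in the state `b`, to the irrep
of dimension `j + 2` (`p = false`) or `j` (`p = true`). -/
def cgCoeff (j u : ℕ) (b p : Bool) : ℝ :=
  match p, b with
  | false, false => Real.sqrt (((j : ℝ) + 1 - u) / (j + 1))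
  | false, true => Real.sqrt (((u : ℝ) + 1) / (j + 1))
  | true, false => Real.sqrt ((u : ℝ) / (j + 1))
  | true, true => -Real.sqrt (((j : ℝ) - u) / (j + 1))

/-- The basis state of the target irrep that goes with `cgCoeff j u b p` (where the latter is not
zero): the number of ones, less one for a new singlet. -/
def cgTarget (u : ℕ) (b p : Bool) : ℕ := u + b.toNat - p.toNat

/-- The protocol interleaves the Clebsch–Gordan transform with the streaming Elias transform. Some
labels `enc (t, u, l)` of the memory stand for the values of three registers: the irrep label `t`
(the length of the second row of a Young diagram with `n` boxes), the basis
state `u` of the irrep of `SU(2)` of dimension `n - 2 * t + 1`, and the number `l` of emitted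
qubits, which is the position of a nonzero bit of `youngDim n t`. One step applies the
Clebsch–Gordan transform to the registers `t`, `u` and the input qubit `b`, which gives new `t`, `u`
and a qubit `p`, and then the streaming Elias transform to `p` and `l`, conditional on `t`; the cell
is returned in the state `|0⟩`. -/
def StreamingProtocol.InterleavesSchurElias (P : StreamingProtocol) : Prop :=
  ∃ enc : ℕ × ℕ × ℕ → ℕ, Function.Injective enc ∧ enc (0, 0, 0) = 0 ∧
    ∀ n t u l : ℕ, 2 * t ≤ n → u ≤ n - 2 * t → (youngDim n t).testBit l = true →
      ∀ (b : Bool) (w : List Bool),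
        P.step n b (Finsupp.single ⟨enc (t, u, l), false, w⟩ 1) =
          ∑ p : Bool,
            Finsupp.single
              ⟨enc (t + p.toNat, cgTarget u b p, (eliasStep n (t + p.toNat) l p).1), false,
                w ++ (eliasStep n (t + p.toNat) l p).2⟩
              ((cgCoeff (n - 2 * t) u b p : ℝ) : ℂ)

end Concentration

end

namespace Concentration

/-! ### Binary addition -/

/-! The theorem combines Schur–Weyl duality with a prefix-preserving form of binary addition. Let
`A` be the coefficient matrix of `ψ`. In the Schur basis `A^{⊗N}` is the direct sum over `t` of
`det(A)^t Sym^{N-2t}(A)` tensored with the identity on a multiplicity space of dimension `d =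
youngDim N t`. So on each multiplicity space Alice and Bob share an unnormalized maximally entangled
state, whatever `ψ` is. If the basis of that space is labelled by bit strings, with all `2^l`
strings of length `l` for every binary digit 1 of `d` at position `l`, then the strings of length
`l` form `l` EPR pairs.

The multiplicity basis consists of paths in Young's lattice, and `d` at a node is the sum `a + b` of
the dimensions at its two predecessors. The strings can only grow, so strings for `a` and for `b`
must extend injectively to strings for `a + b`. This is binary addition: two blocks of `2^l` strings
merge, by one more bit, into a block of `2^(l+1)`, and a carry continues while the bits of `a` and
`b` differ. The combinatorial core is `addWord_injective`, with counting in `sum_words_add`. The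
representation-theoretic core is `cgTransform_symPower`: Clebsch–Gordan transforms on both sides
turn `Sym^j(A) ⊗ A` into `Sym^{j+1}(A) ⊕ det(A) Sym^{j-1}(A)`. Together they give `jointState_eq`,
which contains the EPR claim and, through the norms of the blocks, the exact yield `spectralYield`.

The yield bounds are entropy estimates. With `x`, `y` the eigenvalues of the reduced state, the
spectrum of its `N`-th power consists of the values `x^(N-k) y^k`, and its entropy is `N` times the
one-copy entropy. The mean word length differs by at most 3 from the mean of `log₂ d`
(`wordsLength_le`, `le_wordsLength`). The latter lies below the entropy, by at most the entropy of
the at most `(N+1)^2` labels `(t, u)` (`logDimSum_le`, `le_logDimSum`). The lag bound follows since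
additional inputs gain linearly and lose only logarithmically.

Finally a concrete machine is built. A partial isometry on basis states extends to a unitary
(`exists_gate`), and the carry loop is unrolled into one gate and one controlled emission per bit
position; this works because `StageInput.tgt` is injective. -/

theorem testBit_add_carry (a b l : ℕ) :
    (a + b).testBit l =
      ((a.testBit l ^^ b.testBit l) ^^ decide (2 ^ l ≤ a % 2 ^ l + b % 2 ^ l)) := by
  have hp : 0 < 2 ^ l := by positivity
  have ha := Nat.mod_lt a hp
  have hb := Nat.mod_lt b hp
  simp only [Nat.testBit_eq_decide_div_mod_eq]
  by_cases h : 2 ^ l ≤ a % 2 ^ l + b % 2 ^ l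
  · rw [Nat.add_div hp, if_pos h]
    simp only [h, decide_true]
    rcases Nat.mod_two_eq_zero_or_one (a / 2 ^ l) with h1 | h1 <;>
    rcases Nat.mod_two_eq_zero_or_one (b / 2 ^ l) with h2 | h2 <;>
    simp [h1, h2] <;> omega
  · rw [Nat.add_div hp, if_neg h]
    simp only [h, decide_false]
    rcases Nat.mod_two_eq_zero_or_one (a / 2 ^ l) with h1 | h1 <;>
    rcases Nat.mod_two_eq_zero_or_one (b / 2 ^ l) with h2 | h2 <;>
    simp [h1, h2] <;> omega

/-- The inequality `2 ^ l ≤ a % 2 ^ l + b % 2 ^ l` encodes a carry into position `l`; this is the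
majority rule of a full adder. -/
theorem carry_succ_iff (a b l : ℕ) :
    2 ^ (l + 1) ≤ a % 2 ^ (l + 1) + b % 2 ^ (l + 1) ↔
      (a.testBit l = true ∧ b.testBit l = true) ∨
        ((a.testBit l = true ∨ b.testBit l = true) ∧ 2 ^ l ≤ a % 2 ^ l + b % 2 ^ l) := by
  have hp : 0 < 2 ^ l := by positivity
  have ha := Nat.mod_lt a hp
  have hb := Nat.mod_lt b hp
  have e1 : a % 2 ^ (l + 1) = a % 2 ^ l + 2 ^ l * (a / 2 ^ l % 2) := Nat.mod_pow_succ
  have e2 : b % 2 ^ (l + 1) = b % 2 ^ l + 2 ^ l * (b / 2 ^ l % 2) := Nat.mod_pow_succ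
  rw [e1, e2]
  simp only [Nat.testBit_eq_decide_div_mod_eq, pow_succ]
  rcases Nat.mod_two_eq_zero_or_one (a / 2 ^ l) with h1 | h1 <;>
  rcases Nat.mod_two_eq_zero_or_one (b / 2 ^ l) with h2 | h2 <;>
  simp [h1, h2] <;> omega

/-- The words output by the carry loop for adding `a` and `b`, from position `l` on. -/
def carryBits (a b : ℕ) : ℕ → ℕ → List Bool
  | 0, _ => []
  | fuel + 1, l =>
      if a.testBit l ≠ b.testBit l then a.testBit l :: carryBits a b fuel (l + 1) else []

theorem eliasCarry_eq (n t fuel l : ℕ) :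
    eliasCarry n t fuel l =
      (l + (carryBits (youngDim n t) (youngDimPred n t) fuel l).length,
        carryBits (youngDim n t) (youngDimPred n t) fuel l) := by
  induction fuel generalizing l with
  | zero => simp [eliasCarry, carryBits]
  | succ k ih =>
    rw [eliasCarry, carryBits]
    split_ifs with h
    · simp [ih]; omega
    · simp

theorem carryBits_getElem (a b fuel l i : ℕ) (hi : i < (carryBits a b fuel l).length) :
    (carryBits a b fuel l)[i] = a.testBit (l + i) ∧ a.testBit (l + i) ≠ b.testBit (l + i) := by
  induction fuel generalizing l i with
  | zero => simp [carryBits] at hi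
  | succ k ih =>
    by_cases h : a.testBit l ≠ b.testBit l
    · have e : carryBits a b (k + 1) l = a.testBit l :: carryBits a b k (l + 1) := by
        rw [carryBits, if_pos h]
      simp only [e] at hi ⊢
      cases i with
      | zero => simpa using h
      | succ i =>
        have := ih (l + 1) i (by simpa using hi)
        rw [show l + (i + 1) = l + 1 + i by ring]
        simpa using this
    · rw [carryBits, if_neg h] at hi
      simp at hi

/-- The loop stops at equal bits or when the fuel is used up; in the latter case the position is at
least `n`, where both bits vanish. -/
theorem testBit_eq_after_carryBits {a b n : ℕ} (ha : a < 2 ^ n) (hb : b < 2 ^ n) (fuel l : ℕ)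
    (hl : n ≤ l + fuel) :
    a.testBit (l + (carryBits a b fuel l).length) =
      b.testBit (l + (carryBits a b fuel l).length) := by
  induction fuel generalizing l with
  | zero =>
    have h2 : 2 ^ n ≤ 2 ^ l := Nat.pow_le_pow_right (by norm_num) hl
    rw [carryBits]
    simp only [List.length_nil, add_zero]
    rw [Nat.testBit_lt_two_pow (ha.trans_le h2), Nat.testBit_lt_two_pow (hb.trans_le h2)]
  | succ k ih =>
    rw [carryBits]
    split_ifs with h
    · rw [List.length_cons, show ∀ x, l + (x + 1) = l + 1 + x by intro x; ring]
      exact ih _ (by omega)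
    · simpa using h

theorem carry_after_carryBits (a b fuel l : ℕ) (h : 2 ^ l ≤ a % 2 ^ l + b % 2 ^ l) :
    2 ^ (l + (carryBits a b fuel l).length) ≤
      a % 2 ^ (l + (carryBits a b fuel l).length) +
        b % 2 ^ (l + (carryBits a b fuel l).length) := by
  induction fuel generalizing l with
  | zero => simpa [carryBits] using h
  | succ k ih =>
    rw [carryBits]
    split_ifs with h1
    · rw [List.length_cons, show ∀ x, l + (x + 1) = l + 1 + x by intro x; ring]
      refine ih _ ?_
      rw [carry_succ_iff]
      refine Or.inr ⟨?_, h⟩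
      revert h1
      cases a.testBit l <;> cases b.testBit l <;> simp
    · simpa using h

/-- One step of the streaming Elias algorithm at a node of size `a + b` with predecessors of sizes
`a` (`p = false`) and `b` (`p = true`). -/
def addWord (a b fuel : ℕ) (p : Bool) (w : List Bool) : List Bool :=
  if (a + b).testBit w.length = false ∨ (if p then a else b).testBit w.length = true then
    w ++ p :: carryBits a b fuel (w.length + 1)
  else w

/-- The bit of the source at `w.length` is 1. If the word is extended, then the other bit is 1 or
the sum bit is 0, and in both cases a carry leaves this position. It runs through the unequal bits
and stops at equal ones, where the sum bit is the carry itself. If the word is not extended, the sum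
bit is 1 by the test. -/
theorem addWord_testBit {a b n fuel : ℕ} (ha : a < 2 ^ n) (hb : b < 2 ^ n) (hn : n ≤ fuel + 1)
    {p : Bool} {w : List Bool} (hw : (if p then b else a).testBit w.length = true) :
    (a + b).testBit (addWord a b fuel p w).length = true := by
  by_cases h : (a + b).testBit w.length = false ∨ (if p then a else b).testBit w.length = true
  · rw [addWord, if_pos h]
    have hc : 2 ^ (w.length + 1) ≤ a % 2 ^ (w.length + 1) + b % 2 ^ (w.length + 1) := by
      rw [carry_succ_iff]
      rw [testBit_add_carry] at h
      by_cases hc : 2 ^ w.length ≤ a % 2 ^ w.length + b % 2 ^ w.length <;>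
        cases p <;> simp only [reduceIte, Bool.false_eq_true] at h hw <;> rw [hw] at h ⊢ <;>
        first | (simp [hc]; done) | simpa [hc] using h
    have h1 := testBit_eq_after_carryBits ha hb fuel (w.length + 1) (by omega)
    have h2 := carry_after_carryBits a b fuel (w.length + 1) hc
    rw [show (w ++ p :: carryBits a b fuel (w.length + 1)).length =
      w.length + 1 + (carryBits a b fuel (w.length + 1)).length by simp; omega]
    rw [testBit_add_carry, h1]
    simpa using h2
  · rw [addWord, if_neg h]
    push Not at h
    simpa using h.1

/-- If `v` were shorter, it would be extended, and all bits of the common result beyond position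
`v.length` would come from its carry loop. If `w` is extended too, its new bit `q` sits at a
position where the loop wrote the bit of `a` and the bits of `a` and `b` differ; but the predecessor
chosen by `q` has a 1 there, so the bit of `a` is not `q`. If `w` is unchanged, the loop of `v`
stopped at `w.length` at equal bits, while `w` stays unchanged only if the bits differ. -/
theorem not_length_lt_of_addWord_eq {a b n fuel : ℕ} {p q : Bool} {v w : List Bool}
    (ha : a < 2 ^ n) (hb : b < 2 ^ n) (hn : n ≤ fuel + 1)
    (hw : (if q then b else a).testBit w.length = true)
    (h : addWord a b fuel p v = addWord a b fuel q w) : ¬ v.length < w.length := by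
  intro hlt
  have hv' : (a + b).testBit v.length = false ∨ (if p then a else b).testBit v.length = true := by
    by_contra hcon
    rw [addWord, if_neg hcon] at h
    have : w.length ≤ (addWord a b fuel q w).length := by
      rw [addWord]; split_ifs <;> simp
    rw [← h] at this
    omega
  set W := addWord a b fuel p v with hW
  have e : W = v ++ p :: carryBits a b fuel (v.length + 1) := by rw [hW, addWord, if_pos hv']
  have eq : ∀ i, v.length < i → ∀ hi : i < W.length,
      W[i] = a.testBit i ∧ a.testBit i ≠ b.testBit i := by
    intro i h1 hi
    have hi' : i - (v.length + 1) < (carryBits a b fuel (v.length + 1)).length := by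
      rw [e] at hi; simp at hi; omega
    have := carryBits_getElem a b fuel (v.length + 1) (i - (v.length + 1)) hi'
    rw [show v.length + 1 + (i - (v.length + 1)) = i by omega] at this
    refine ⟨?_, this.2⟩
    rw [← this.1]
    simp only [e]
    rw [List.getElem_append_right h1.le]
    simp only [show i - v.length = i - (v.length + 1) + 1 by omega, List.getElem_cons_succ]
  have hend := testBit_eq_after_carryBits ha hb fuel (v.length + 1) (by omega)
  have hlen : W.length = v.length + 1 + (carryBits a b fuel (v.length + 1)).length := by
    rw [e]; simp; omega
  rw [← hlen] at hend
  by_cases hw' : (a + b).testBit w.length = false ∨ (if q then a else b).testBit w.length = true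
  · have e' : W = w ++ q :: carryBits a b fuel (w.length + 1) := by
      rw [h, addWord, if_pos hw']
    have hi : w.length < W.length := by rw [e']; simp
    obtain ⟨h1, h2⟩ := eq _ hlt hi
    have h3 : W[w.length] = q := by simp [e']
    rw [h3] at h1
    subst h1
    cases h4 : a.testBit w.length <;> simp_all
  · have e' : W = w := by rw [h, addWord, if_neg hw']
    rw [e'] at hend
    push Not at hw'
    clear h eq
    cases q <;> simp_all

/-- The lengths agree by the preceding lemma, so `v` and `w` are equal as prefixes of one word. If
`p ≠ q`, both predecessors have a 1 at this position; then both words are extended, and the first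
new bit tells `p` from `q`. -/
theorem addWord_injective {a b n fuel : ℕ} {p q : Bool} {v w : List Bool}
    (ha : a < 2 ^ n) (hb : b < 2 ^ n) (hn : n ≤ fuel + 1)
    (hv : (if p then b else a).testBit v.length = true)
    (hw : (if q then b else a).testBit w.length = true)
    (h : addWord a b fuel p v = addWord a b fuel q w) : p = q ∧ v = w := by
  have hl : v.length = w.length :=
    le_antisymm (not_lt.1 (not_length_lt_of_addWord_eq ha hb hn hv h.symm))
      (not_lt.1 (not_length_lt_of_addWord_eq ha hb hn hw h))
  have hp : p = q ∨ (a.testBit v.length = true ∧ b.testBit v.length = true) := by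
    rw [← hl] at hw
    clear h
    cases p <;> cases q <;> simp_all
  have hpre : v = w ∧ (a.testBit v.length = true ∧ b.testBit v.length = true → p = q) := by
    have hpref : ∀ (r : Bool) (x : List Bool), x <+: addWord a b fuel r x := by
      intro r x; rw [addWord]; split_ifs <;> simp
    have hvw : v = w := by
      have h1 := hpref p v
      have h2 := hpref q w
      rw [h] at h1
      exact (List.prefix_of_prefix_length_le h1 h2 hl.le).eq_of_length hl
    refine ⟨hvw, fun hab => ?_⟩
    subst hvw
    rw [addWord, addWord, if_pos, if_pos] at h
    · simpa using h
    · right; cases q <;> simp [hab]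
    · right; cases p <;> simp [hab]
  exact ⟨hp.elim id hpre.2, hpre.1⟩

/-! ### The blocks of words that label a multiplicity space -/

/-- The words whose length is the position of a 1 in the binary expansion of `d`. -/
noncomputable def words (d : ℕ) : Finset (List Bool) :=
  ((Finset.range d).filter fun l => d.testBit l = true).biUnion fun l =>
    (Finset.univ : Finset (Fin l → Bool)).image List.ofFn

theorem lt_of_testBit {d l : ℕ} (h : d.testBit l = true) : l < d :=
  Nat.lt_two_pow_self.trans_le (Nat.ge_two_pow_of_testBit h)

theorem mem_words {d : ℕ} {w : List Bool} : w ∈ words d ↔ d.testBit w.length = true := by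
  simp only [words, Finset.mem_biUnion, Finset.mem_filter, Finset.mem_range, Finset.mem_image,
    Finset.mem_univ, true_and]
  constructor
  · rintro ⟨l, ⟨-, h⟩, f, rfl⟩
    simpa using h
  · intro h
    exact ⟨w.length, ⟨lt_of_testBit h, h⟩, fun i => w[i], by simp⟩

theorem sum_words {M : Type*} [AddCommMonoid M] (d : ℕ) (f : ℕ → M) :
    ∑ w ∈ words d, f w.length =
      ∑ l ∈ (Finset.range d).filter (fun l => d.testBit l = true), 2 ^ l • f l := by
  rw [words, Finset.sum_biUnion]
  · refine Finset.sum_congr rfl fun l _ => ?_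
    rw [Finset.sum_image fun x _ y _ h => List.ofFn_injective h]
    simp
  · intro l _ l' _ hne
    rw [Function.onFun, Finset.disjoint_left]
    intro w h1 h2
    simp only [Finset.mem_image, Finset.mem_univ, true_and] at h1 h2
    obtain ⟨x, rfl⟩ := h1
    obtain ⟨y, hy⟩ := h2
    exact hne (by simpa using (congrArg List.length hy).symm)

theorem sum_testBit_two_pow (d k : ℕ) (hd : d < 2 ^ k) :
    ∑ l ∈ (Finset.range k).filter (fun l => d.testBit l = true), 2 ^ l = d := by
  induction k generalizing d with
  | zero => simp at hd; simp [hd]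
  | succ k ih =>
    rw [Finset.sum_filter, Finset.sum_range_succ']
    have h1 := ih (d / 2) (by rw [pow_succ] at hd; omega)
    rw [Finset.sum_filter] at h1
    have : ∀ i, (if d.testBit (i + 1) = true then 2 ^ (i + 1) else 0) =
        2 * (if (d / 2).testBit i = true then 2 ^ i else 0) := by
      intro i
      rw [Nat.testBit_succ]
      split_ifs <;> ring
    rw [Finset.sum_congr rfl fun i _ => this i, ← Finset.mul_sum, h1, Nat.testBit_zero]
    split_ifs with h <;> simp at h <;> omega

theorem card_words (d : ℕ) : (words d).card = d := by
  rw [Finset.card_eq_sum_ones, sum_words d fun _ => 1]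
  simpa using sum_testBit_two_pow d d Nat.lt_two_pow_self

/-- The words of `a + b` are the disjoint union of the words that come from `a` and from `b`. -/
theorem sum_words_add {M : Type*} [AddCommMonoid M] {a b n fuel : ℕ}
    (ha : a < 2 ^ n) (hb : b < 2 ^ n) (hn : n ≤ fuel + 1) (F : List Bool → M) :
    ∑ w ∈ words (a + b), F w =
      ∑ w ∈ words a, F (addWord a b fuel false w) + ∑ w ∈ words b, F (addWord a b fuel true w) := by
  classical
  have inj : ∀ p, Set.InjOn (addWord a b fuel p) (words (if p then b else a)) := by
    intro p v hv w hw h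
    exact (addWord_injective ha hb hn (mem_words.1 hv) (mem_words.1 hw) h).2
  have disj : Disjoint ((words a).image (addWord a b fuel false))
      ((words b).image (addWord a b fuel true)) := by
    rw [Finset.disjoint_left]
    intro x h1 h2
    obtain ⟨v, hv, rfl⟩ := Finset.mem_image.1 h1
    obtain ⟨w, hw, h⟩ := Finset.mem_image.1 h2
    have := (addWord_injective (p := true) (q := false) ha hb hn (mem_words.1 hw)
      (mem_words.1 hv) h).1
    simp at this
  have key : words (a + b) = ((words a).image (addWord a b fuel false)) ∪
      ((words b).image (addWord a b fuel true)) := by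
    symm
    -- Surjectivity is a matter of counting: the two images are disjoint and have `a` and `b`
    -- elements.
    apply Finset.eq_of_subset_of_card_le
    · intro x hx
      rw [Finset.mem_union, Finset.mem_image, Finset.mem_image] at hx
      rw [mem_words]
      rcases hx with ⟨w, hw, rfl⟩ | ⟨w, hw, rfl⟩
      · exact addWord_testBit (p := false) ha hb hn (mem_words.1 hw)
      · exact addWord_testBit (p := true) ha hb hn (mem_words.1 hw)
    · rw [Finset.card_union_of_disjoint disj, Finset.card_image_of_injOn (s := words a) (inj false),
        Finset.card_image_of_injOn (s := words b) (inj true), card_words, card_words, card_words]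
  rw [key, Finset.sum_union disj, Finset.sum_image (s := words a) (inj false),
    Finset.sum_image (s := words b) (inj true)]

/-! ### The streaming Elias step on Young's lattice -/

theorem youngDim_eq_zero {n t : ℕ} (h : n < 2 * t) : youngDim n t = 0 := by
  cases t with
  | zero => omega
  | succ t => cases n with
    | zero => rfl
    | succ n => rw [youngDim, if_neg (by omega)]

theorem youngDim_succ {n t : ℕ} (h : 2 * t ≤ n + 1) :
    youngDim (n + 1) t = youngDim n t + youngDimPred n t := by
  cases t with
  | zero => simp [youngDim, youngDimPred]
  | succ t => rw [youngDim, if_pos h, youngDimPred]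

theorem youngDim_add_pred_le (n : ℕ) :
    (∀ t, youngDim n t ≤ 2 ^ n) ∧ ∀ t, youngDimPred n t ≤ 2 ^ n := by
  have aux : ∀ n, (∀ t, youngDim n t ≤ 2 ^ n) → ∀ t, youngDimPred n t ≤ 2 ^ n := by
    intro n h t
    cases t with
    | zero => simp [youngDimPred]
    | succ t => exact h t
  have main : ∀ t, youngDim n t ≤ 2 ^ n := by
    induction n with
    | zero => intro t; cases t <;> simp [youngDim]
    | succ n ih =>
      intro t
      by_cases h : 2 * t ≤ n + 1
      · rw [youngDim_succ h, pow_succ]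
        have := ih t
        have := aux n ih t
        omega
      · rw [youngDim_eq_zero (by omega)]; simp
  exact ⟨main, aux n main⟩

theorem youngDim_lt (n t : ℕ) : youngDim n t < 2 ^ (n + 1) :=
  ((youngDim_add_pred_le n).1 t).trans_lt (Nat.pow_lt_pow_right (by norm_num) (by omega))

theorem youngDimPred_lt (n t : ℕ) : youngDimPred n t < 2 ^ (n + 1) :=
  ((youngDim_add_pred_le n).2 t).trans_lt (Nat.pow_lt_pow_right (by norm_num) (by omega))

theorem le_of_testBit_youngDim {n t l : ℕ} (h : (youngDim n t).testBit l = true) : l ≤ n := by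
  have h1 := Nat.ge_two_pow_of_testBit h
  have h2 := (youngDim_add_pred_le n).1 t
  exact (Nat.pow_le_pow_iff_right (by norm_num)).1 (h1.trans h2)

/-- The word after the streaming Elias step. -/
def eliasWord (n t : ℕ) (p : Bool) (w : List Bool) : List Bool :=
  w ++ (eliasStep n t w.length p).2

theorem eliasWord_length (n t : ℕ) (p : Bool) (w : List Bool) :
    (eliasWord n t p w).length = (eliasStep n t w.length p).1 := by
  rw [eliasWord, eliasStep, eliasCarry_eq]
  split_ifs <;> simp <;> omega

theorem eliasWord_eq {n t : ℕ} (h : 2 * t ≤ n + 1) (p : Bool) (w : List Bool) :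
    eliasWord n t p w = addWord (youngDim n t) (youngDimPred n t) (n + 1) p w := by
  rw [eliasWord, eliasStep, addWord, youngDim_succ h, eliasCarry_eq]
  have : (if p then youngDim n t else youngDimPred n t).testBit w.length =
      (if p = true then youngDim n t else youngDimPred n t).testBit w.length := rfl
  split_ifs <;> simp_all

theorem sum_words_youngDim_succ {M : Type*} [AddCommMonoid M] {n t : ℕ} (h : 2 * t ≤ n + 1)
    (F : List Bool → M) :
    ∑ w ∈ words (youngDim (n + 1) t), F w =
      ∑ w ∈ words (youngDim n t), F (eliasWord n t false w) +
        ∑ w ∈ words (youngDimPred n t), F (eliasWord n t true w) := by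
  simp only [eliasWord_eq h]
  rw [youngDim_succ h]
  exact sum_words_add (youngDim_lt n t) (youngDimPred_lt n t) (by omega) F

/-- If two streaming Elias steps arrive at the same node with the same word, they are the same. -/
theorem eliasWord_injective {n t t' : ℕ} {p q : Bool} {v w : List Bool}
    (hv : v ∈ words (youngDim n t)) (hw : w ∈ words (youngDim n t'))
    (ht : 2 * (t + p.toNat) ≤ n + 1) (htt : t + p.toNat = t' + q.toNat)
    (h : eliasWord n (t + p.toNat) p v = eliasWord n (t' + q.toNat) q w) :
    p = q ∧ t = t' ∧ v = w := by
  rw [← htt, eliasWord_eq ht, eliasWord_eq ht] at h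
  have hv' : (if p then youngDimPred n (t + p.toNat) else youngDim n (t + p.toNat)).testBit
      v.length = true := by
    have := mem_words.1 hv
    cases p <;> simpa [youngDimPred] using this
  have hw' : (if q then youngDimPred n (t + p.toNat) else youngDim n (t + p.toNat)).testBit
      w.length = true := by
    have := mem_words.1 hw
    rw [htt]
    cases q <;> simpa [youngDimPred] using this
  obtain ⟨h1, h2⟩ := addWord_injective (youngDim_lt n _) (youngDimPred_lt n _) (by omega) hv' hw' h
  subst h1
  exact ⟨rfl, by omega, h2⟩

theorem eliasWord_mem {n t : ℕ} {p : Bool} {w : List Bool}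
    (hw : w ∈ words (youngDim n t)) (ht : 2 * (t + p.toNat) ≤ n + 1) :
    eliasWord n (t + p.toNat) p w ∈ words (youngDim (n + 1) (t + p.toNat)) := by
  have hw' : (if p then youngDimPred n (t + p.toNat) else youngDim n (t + p.toNat)).testBit
      w.length = true := by
    have := mem_words.1 hw
    cases p <;> simpa [youngDimPred] using this
  rw [mem_words, eliasWord_eq ht, youngDim_succ ht]
  exact addWord_testBit (youngDim_lt n _) (youngDimPred_lt n _) (by omega) hw'

/-! ### The Clebsch–Gordan transform -/

/-- The Clebsch–Gordan coefficients into total label `v`, for an input qubit `|0⟩`. -/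
noncomputable def cgZero (j v : ℕ) : ℝ := Real.sqrt (((j : ℝ) + 1 - v) / (j + 1))

/-- The Clebsch–Gordan coefficients into total label `v`, for an input qubit `|1⟩`. -/
noncomputable def cgOne (j v : ℕ) : ℝ := Real.sqrt ((v : ℝ) / (j + 1))

/-- The Clebsch–Gordan transform of coefficients `G u b`. -/
noncomputable def cgTransform (j : ℕ) (G : ℕ → Bool → ℂ) : Bool → ℕ → ℂ
  | false, v => cgZero j v * G v false + cgOne j v * G (v - 1) true
  | true, v => cgOne j (v + 1) * G (v + 1) false - cgZero j (v + 1) * G v true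

theorem cgZero_sq {j v : ℕ} (h : v ≤ j + 1) : cgZero j v ^ 2 = ((j : ℝ) + 1 - v) / (j + 1) := by
  have : (v : ℝ) ≤ j + 1 := by exact_mod_cast h
  exact Real.sq_sqrt (div_nonneg (by linarith) (by positivity))

theorem cgOne_sq (j v : ℕ) : cgOne j v ^ 2 = (v : ℝ) / (j + 1) :=
  Real.sq_sqrt (by positivity)

theorem cgZero_sq_add_cgOne_sq {j v : ℕ} (h : v ≤ j + 1) : cgZero j v ^ 2 + cgOne j v ^ 2 = 1 := by
  rw [cgZero_sq h, cgOne_sq]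
  have : (j : ℝ) + 1 ≠ 0 := by positivity
  field_simp
  ring

theorem cgZero_zero (j : ℕ) : cgZero j 0 = 1 := by
  have : (j : ℝ) + 1 ≠ 0 := by positivity
  simp [cgZero, this]

theorem cgZero_last (j : ℕ) : cgZero j (j + 1) = 0 := by simp [cgZero]

theorem cgOne_zero (j : ℕ) : cgOne j 0 = 0 := by simp [cgOne]

theorem cgOne_last (j : ℕ) : cgOne j (j + 1) = 1 := by
  have : (j : ℝ) + 1 ≠ 0 := by positivity
  simp [cgOne, this]

theorem cgCoeff_false_false (j u : ℕ) : cgCoeff j u false false = cgZero j u := rfl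

theorem cgCoeff_true_false (j u : ℕ) : cgCoeff j u true false = cgOne j (u + 1) := by
  simp [cgCoeff, cgOne]

theorem cgCoeff_false_true (j u : ℕ) : cgCoeff j u false true = cgOne j u := rfl

theorem cgCoeff_true_true (j u : ℕ) : cgCoeff j u true true = -cgZero j (u + 1) := by
  simp [cgCoeff, cgZero]

theorem cgCoeff_orthonormal {j u u' : ℕ} (hu : u ≤ j) (hu' : u' ≤ j) (b b' : Bool) :
    ∑ p : Bool, (if cgTarget u b p = cgTarget u' b' p then
      cgCoeff j u b p * cgCoeff j u' b' p else 0) = if u = u' ∧ b = b' then 1 else 0 := by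
  have h1 := cgZero_sq_add_cgOne_sq (j := j) (v := u) (by omega)
  have h2 := cgZero_sq_add_cgOne_sq (j := j) (v := u + 1) (by omega)
  cases b <;> cases b' <;>
    simp only [Fintype.sum_bool, cgTarget, cgCoeff_false_false, cgCoeff_true_false,
      cgCoeff_false_true, cgCoeff_true_true, Bool.toNat_true, Bool.toNat_false, add_zero,
      Nat.sub_zero, Nat.add_sub_cancel, and_true, and_false, reduceIte, Bool.false_eq_true,
      Bool.true_eq_false]
  · rcases eq_or_ne u u' with rfl | h
    · simp only [reduceIte]; linarith
    · rw [if_neg h, if_neg h, add_zero]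
      split_ifs with h3
      -- Truncated subtraction in `cgTarget` sends both 0 and 1 to 0 for `p = true` and input 0. The
      -- spurious collision does no harm, because the coefficient at 0 vanishes.
      · rcases Nat.eq_zero_or_pos u with rfl | h4
        · simp [cgOne_zero]
        · have : u' = 0 := by omega
          subst this
          simp [cgOne_zero]
      · rfl
  · by_cases h : u = u' + 1
    · subst h; simp; ring
    · rw [if_neg h]
      split_ifs with h3
      · have : u = 0 := by omega
        subst this
        simp [cgOne_zero]
      · simp
  · by_cases h : u' = u + 1
    · subst h; simp; ring
    · rw [if_neg (Ne.symm h)]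
      split_ifs with h3
      · have : u' = 0 := by omega
        subst this
        simp [cgOne_zero]
      · simp
  · rcases eq_or_ne u u' with rfl | h
    · simp only [reduceIte]; linarith
    · rw [if_neg h, if_neg (by omega), if_neg h, add_zero]

/-- Reindexing by the target label. The ranges have the dimensions `j + 2` and `j` of the target
irreps; all boundary terms carry one of the zeros `cgOne j 0` and `cgZero j (j + 1)`. -/
theorem sum_cgCoeff_smul {W : Type*} [AddCommGroup W] [Module ℂ W] (j : ℕ) (G : ℕ → Bool → ℂ)
    (H : Bool → ℕ → W) :
    ∑ b : Bool, ∑ u ∈ Finset.range (j + 1), ∑ p : Bool,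
        ((cgCoeff j u b p : ℝ) * G u b) • H p (cgTarget u b p) =
      ∑ p : Bool, ∑ v ∈ Finset.range (j + 2 - 2 * p.toNat), cgTransform j G p v • H p v := by
  simp only [Fintype.sum_bool, cgTarget, cgCoeff_false_false, cgCoeff_true_false,
      cgCoeff_false_true, cgCoeff_true_true, Bool.toNat_true, Bool.toNat_false, add_zero,
      Nat.sub_zero, Nat.add_sub_cancel, cgTransform, add_smul, sub_smul, Finset.sum_add_distrib,
      Finset.sum_sub_distrib, mul_zero, mul_one]
  have e1 : ∑ v ∈ Finset.range (j + 2), ((cgZero j v : ℂ) * G v false) • H false v =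
      ∑ u ∈ Finset.range (j + 1), ((cgZero j u : ℂ) * G u false) • H false u := by
    rw [Finset.sum_range_succ, cgZero_last]; simp
  have e2 : ∑ v ∈ Finset.range (j + 2), ((cgOne j v : ℂ) * G (v - 1) true) • H false v =
      ∑ u ∈ Finset.range (j + 1), ((cgOne j (u + 1) : ℂ) * G u true) • H false (u + 1) := by
    rw [Finset.sum_range_succ', cgOne_zero]; simp
  have e3 : ∑ u ∈ Finset.range (j + 1), ((cgOne j u : ℂ) * G u false) • H true (u - 1) =
      ∑ v ∈ Finset.range j, ((cgOne j (v + 1) : ℂ) * G (v + 1) false) • H true v := by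
    rw [Finset.sum_range_succ', cgOne_zero]; simp
  have e4 : ∑ u ∈ Finset.range (j + 1), (((-cgZero j (u + 1) : ℝ) : ℂ) * G u true) • H true u =
      -∑ v ∈ Finset.range j, ((cgZero j (v + 1) : ℂ) * G v true) • H true v := by
    rw [Finset.sum_range_succ, cgZero_last]; simp
  rw [e1, e2, e3, e4]
  abel

/-- For each intermediate number of ones the transform acts on a plane by a reflection; the two
extreme numbers of ones span lines that are left fixed. -/
theorem sum_norm_cgTransform_sq (j : ℕ) (G : ℕ → Bool → ℂ) :
    ∑ p : Bool, ∑ v ∈ Finset.range (j + 2 - 2 * p.toNat), ‖cgTransform j G p v‖ ^ 2 =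
      ∑ b : Bool, ∑ u ∈ Finset.range (j + 1), ‖G u b‖ ^ 2 := by
  have rot : ∀ (α β : ℝ) (x y : ℂ), α ^ 2 + β ^ 2 = 1 →
      ‖(α : ℂ) * x + β * y‖ ^ 2 + ‖(β : ℂ) * x - α * y‖ ^ 2 = ‖x‖ ^ 2 + ‖y‖ ^ 2 := by
    intro α β x y h
    simp only [Complex.sq_norm, Complex.normSq_apply, Complex.add_re, Complex.add_im,
      Complex.sub_re, Complex.sub_im, Complex.re_ofReal_mul, Complex.im_ofReal_mul]
    linear_combination (x.re * x.re + x.im * x.im + y.re * y.re + y.im * y.im) * h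
  simp only [Fintype.sum_bool, Bool.toNat_true, Bool.toNat_false, mul_zero, mul_one,
    Nat.add_sub_cancel, Nat.sub_zero]
  rw [Finset.sum_range_succ (fun u => ‖G u true‖ ^ 2),
    Finset.sum_range_succ' (fun u => ‖G u false‖ ^ 2),
    Finset.sum_range_succ (fun u => ‖cgTransform j G false u‖ ^ 2),
    Finset.sum_range_succ' (fun u => ‖cgTransform j G false u‖ ^ 2)]
  have h0 : cgTransform j G false 0 = G 0 false := by
    simp [cgTransform, cgZero_zero, cgOne_zero]
  have h1 : cgTransform j G false (j + 1) = G j true := by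
    simp [cgTransform, cgZero_last, cgOne_last]
  have h2 : ∑ v ∈ Finset.range j, ‖cgTransform j G false (v + 1)‖ ^ 2 +
      ∑ v ∈ Finset.range j, ‖cgTransform j G true v‖ ^ 2 =
      ∑ v ∈ Finset.range j, ‖G (v + 1) false‖ ^ 2 + ∑ v ∈ Finset.range j, ‖G v true‖ ^ 2 := by
    rw [← Finset.sum_add_distrib, ← Finset.sum_add_distrib]
    refine Finset.sum_congr rfl fun v hv => ?_
    have hv' := Finset.mem_range.1 hv
    exact rot _ _ _ _ (cgZero_sq_add_cgOne_sq (by omega))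
  rw [h0, h1]
  linarith

/-! ### Symmetric powers of a two-by-two matrix -/

/-- The coefficients of `(∑ b c, A b c * x b * y c) ^ j`. -/
noncomputable def symCoeff (A : Bool → Bool → ℂ) : ℕ → ℤ → ℤ → ℂ
  | 0, u, v => if u = 0 ∧ v = 0 then 1 else 0
  | j + 1, u, v =>
      A false false * symCoeff A j u v + A false true * symCoeff A j u (v - 1) +
        A true false * symCoeff A j (u - 1) v + A true true * symCoeff A j (u - 1) (v - 1)

theorem symCoeff_swap (A : Bool → Bool → ℂ) (j : ℕ) (u v : ℤ) :
    symCoeff A j u v = symCoeff (fun b c => A c b) j v u := by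
  induction j generalizing u v with
  | zero => simp [symCoeff, and_comm]
  | succ j ih => simp only [symCoeff, ih]; ring

theorem symCoeff_eq_zero (A : Bool → Bool → ℂ) (j : ℕ) (u v : ℤ) (h : u < 0 ∨ j < u) :
    symCoeff A j u v = 0 := by
  induction j generalizing u v with
  | zero =>
    rw [symCoeff, if_neg]
    rintro ⟨rfl, -⟩
    simp at h
  | succ j ih =>
    push_cast at h
    rw [symCoeff, ih u v (by omega), ih u (v - 1) (by omega), ih (u - 1) v (by omega),
      ih (u - 1) (v - 1) (by omega)]
    ring

theorem symCoeff_eq_zero_right (A : Bool → Bool → ℂ) (j : ℕ) (u v : ℤ) (h : v < 0 ∨ j < v) :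
    symCoeff A j u v = 0 := by
  rw [symCoeff_swap, symCoeff_eq_zero _ _ _ _ h]

/-- With `F = ∑ b c, A b c * x b * y c`, this compares coefficients in `x₁ ∂F^(j+1)/∂x₁ = (j+1) x₁
(∂F/∂x₁) F^j`. The three lemmas below do the same for the other variables. -/
theorem mul_symCoeff_succ (A : Bool → Bool → ℂ) (j : ℕ) (u v : ℤ) :
    (u : ℂ) * symCoeff A (j + 1) u v =
      (j + 1) * (A true false * symCoeff A j (u - 1) v +
        A true true * symCoeff A j (u - 1) (v - 1)) := by
  induction j generalizing u v with
  | zero =>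
    simp only [symCoeff]
    by_cases h0 : u = 0
    · subst h0; simp
    · by_cases h1 : u = 1
      · subst h1; simp
      · have : u - 1 ≠ 0 := by omega
        simp [h0, this]
  | succ j ih =>
    have e1 := ih u v
    have e2 := ih u (v - 1)
    have e3 := ih (u - 1) v
    have e4 := ih (u - 1) (v - 1)
    rw [symCoeff]
    have d1 : symCoeff A (j + 1) (u - 1) v =
      A false false * symCoeff A j (u - 1) v + A false true * symCoeff A j (u - 1) (v - 1) +
        A true false * symCoeff A j (u - 1 - 1) v +
        A true true * symCoeff A j (u - 1 - 1) (v - 1) := rfl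
    have d2 : symCoeff A (j + 1) (u - 1) (v - 1) =
      A false false * symCoeff A j (u - 1) (v - 1) +
        A false true * symCoeff A j (u - 1) (v - 1 - 1) +
        A true false * symCoeff A j (u - 1 - 1) (v - 1) +
        A true true * symCoeff A j (u - 1 - 1) (v - 1 - 1) := rfl
    push_cast at e3 e4 ⊢
    linear_combination A false false * e1 + A false true * e2 + A true false * e3 +
      A true true * e4 - (j + 1) * A true false * d1 - (j + 1) * A true true * d2

theorem sub_mul_symCoeff_succ (A : Bool → Bool → ℂ) (j : ℕ) (u v : ℤ) :
    ((j : ℂ) + 1 - u) * symCoeff A (j + 1) u v =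
      (j + 1) * (A false false * symCoeff A j u v +
        A false true * symCoeff A j u (v - 1)) := by
  have h := mul_symCoeff_succ A j u v
  have d : symCoeff A (j + 1) u v =
      A false false * symCoeff A j u v + A false true * symCoeff A j u (v - 1) +
        A true false * symCoeff A j (u - 1) v +
        A true true * symCoeff A j (u - 1) (v - 1) := rfl
  linear_combination (j + 1) * d - h

theorem mul_symCoeff_succ_right (A : Bool → Bool → ℂ) (j : ℕ) (u v : ℤ) :
    (v : ℂ) * symCoeff A (j + 1) u v =
      (j + 1) * (A false true * symCoeff A j u (v - 1) +
        A true true * symCoeff A j (u - 1) (v - 1)) := by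
  simp only [symCoeff_swap A]
  exact mul_symCoeff_succ _ j v u

theorem sub_mul_symCoeff_succ_right (A : Bool → Bool → ℂ) (j : ℕ) (u v : ℤ) :
    ((j : ℂ) + 1 - v) * symCoeff A (j + 1) u v =
      (j + 1) * (A false false * symCoeff A j u v +
        A true false * symCoeff A j (u - 1) v) := by
  simp only [symCoeff_swap A]
  exact sub_mul_symCoeff_succ _ j v u

/-- The norm of the monomial with index `u` in the `j`-th symmetric power. -/
noncomputable def symNorm (j u : ℕ) : ℝ := Real.sqrt (1 / (j.choose u : ℝ))

theorem cgZero_mul_symNorm {j v : ℕ} (h : v ≤ j) :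
    cgZero j v * symNorm j v = symNorm (j + 1) v := by
  have h1 : (v : ℝ) ≤ j := by exact_mod_cast h
  rw [cgZero, symNorm, symNorm, ← Real.sqrt_mul (div_nonneg (by linarith) (by positivity))]
  congr 1
  have c1 : (j.choose v : ℝ) ≠ 0 := by exact_mod_cast (Nat.choose_pos h).ne'
  have c2 : ((j + 1).choose v : ℝ) ≠ 0 := by exact_mod_cast (Nat.choose_pos (by omega)).ne'
  have e := Nat.choose_mul_succ_eq j v
  have e' : (j.choose v : ℝ) * (j + 1) = (j + 1).choose v * (j + 1 - v) := by
    have := congrArg (Nat.cast (R := ℝ)) e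
    rw [Nat.cast_mul, Nat.cast_mul, Nat.cast_sub (by omega)] at this
    push_cast at this
    exact this
  field_simp
  linarith

theorem cgOne_mul_symNorm {j v : ℕ} (h : v ≤ j) :
    cgOne j (v + 1) * symNorm j v = symNorm (j + 1) (v + 1) := by
  rw [cgOne, symNorm, symNorm, ← Real.sqrt_mul (by positivity)]
  congr 1
  have c1 : (j.choose v : ℝ) ≠ 0 := by exact_mod_cast (Nat.choose_pos h).ne'
  have c2 : ((j + 1).choose (v + 1) : ℝ) ≠ 0 := by exact_mod_cast (Nat.choose_pos (by omega)).ne'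
  have e : ((j : ℝ) + 1) * j.choose v = (j + 1).choose (v + 1) * (v + 1) := by
    exact_mod_cast Nat.add_one_mul_choose_eq j v
  push_cast
  field_simp
  linarith

theorem cgOne_mul_symNorm_down {i v : ℕ} (h : v ≤ i) :
    cgOne (i + 1) (v + 1) * symNorm (i + 1) (v + 1) =
      (v + 1) / Real.sqrt ((i + 1) * (i + 2)) * symNorm i v := by
  have h3 : ((v : ℝ) + 1) = Real.sqrt ((v + 1) ^ 2) := (Real.sqrt_sq (by positivity)).symm
  rw [cgOne, symNorm, symNorm, ← Real.sqrt_mul (by positivity)]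
  conv_rhs => rw [h3]
  rw [← Real.sqrt_div (by positivity), ← Real.sqrt_mul (by positivity)]
  congr 1
  have c1 : (i.choose v : ℝ) ≠ 0 := by exact_mod_cast (Nat.choose_pos h).ne'
  have c2 : ((i + 1).choose (v + 1) : ℝ) ≠ 0 := by exact_mod_cast (Nat.choose_pos (by omega)).ne'
  have e : ((i : ℝ) + 1) * i.choose v = (i + 1).choose (v + 1) * (v + 1) := by
    exact_mod_cast Nat.add_one_mul_choose_eq i v
  have e2 : (i : ℝ) + 1 + 1 = i + 2 := by ring
  push_cast
  rw [e2]
  field_simp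
  linarith

theorem cgZero_mul_symNorm_down {i v : ℕ} (h : v ≤ i) :
    cgZero (i + 1) (v + 1) * symNorm (i + 1) v =
      (i + 1 - v) / Real.sqrt ((i + 1) * (i + 2)) * symNorm i v := by
  have h1 : (v : ℝ) ≤ i := by exact_mod_cast h
  have h3 : ((i : ℝ) + 1 - v) = Real.sqrt ((i + 1 - v) ^ 2) :=
    (Real.sqrt_sq (by linarith)).symm
  rw [cgZero, symNorm, symNorm,
    ← Real.sqrt_mul (div_nonneg (by push_cast; linarith) (by positivity))]
  conv_rhs => rw [h3]
  rw [← Real.sqrt_div (by positivity), ← Real.sqrt_mul (by positivity)]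
  congr 1
  have c1 : (i.choose v : ℝ) ≠ 0 := by exact_mod_cast (Nat.choose_pos h).ne'
  have c2 : ((i + 1).choose v : ℝ) ≠ 0 := by exact_mod_cast (Nat.choose_pos (by omega)).ne'
  have e := Nat.choose_mul_succ_eq i v
  have e' : (i.choose v : ℝ) * (i + 1) = (i + 1).choose v * (i + 1 - v) := by
    have := congrArg (Nat.cast (R := ℝ)) e
    rw [Nat.cast_mul, Nat.cast_mul, Nat.cast_sub (by omega)] at this
    push_cast at this
    exact this
  have e2 : (i : ℝ) + 1 + 1 = i + 2 := by ring
  push_cast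
  rw [e2]
  field_simp
  linear_combination (i + 1 - v : ℝ) * e'

/-- In normalized monomials the symmetric component is multiplication of polynomials: the pair `(g₀,
g₁)` goes to `x₀ g₀ + x₁ g₁`. -/
theorem cgTransform_false_symNorm {j v : ℕ} (g : ℤ → Bool → ℂ) (h0 : ∀ b, g (-1) b = 0)
    (h1 : ∀ b, g (j + 1) b = 0) (hv : v ≤ j + 1) :
    cgTransform j (fun u b => symNorm j u * g u b) false v =
      symNorm (j + 1) v * (g v false + g (v - 1) true) := by
  rw [cgTransform, mul_add]
  congr 1
  · rcases hv.lt_or_eq with h | h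
    · rw [← mul_assoc, ← cgZero_mul_symNorm (show v ≤ j by omega)]
      push_cast; rfl
    · subst h
      push_cast
      simp [h1]
  · cases v with
    | zero => simp [h0, cgOne_zero]
    | succ v =>
      rw [← mul_assoc, ← cgOne_mul_symNorm (show v ≤ j by omega)]
      simp

/-- In normalized monomials the singlet component is, up to a constant, `∂g₀/∂x₁ - ∂g₁/∂x₀`. -/
theorem cgTransform_true_symNorm {i v : ℕ} (g : ℤ → Bool → ℂ) (hv : v ≤ i) :
    cgTransform (i + 1) (fun u b => symNorm (i + 1) u * g u b) true v =
      (symNorm i v : ℂ) * (1 / Real.sqrt ((i + 1) * (i + 2)) : ℝ) *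
        ((v + 1) * g (v + 1) false - (i + 1 - v) * g v true) := by
  have h1 := congrArg Complex.ofReal (cgOne_mul_symNorm_down hv)
  have h2 := congrArg Complex.ofReal (cgZero_mul_symNorm_down hv)
  rw [Complex.ofReal_mul] at h1 h2
  rw [cgTransform, ← mul_assoc, ← mul_assoc, h1, h2]
  push_cast
  ring

/-- The matrix of the `j`-th symmetric power of `A` in the orthonormal basis. -/
noncomputable def symPower (A : Bool → Bool → ℂ) (j u v : ℕ) : ℂ :=
  symNorm j u * (symNorm j v * symCoeff A j u v)

/-- The determinant. -/
def detTwo (A : Bool → Bool → ℂ) : ℂ :=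
  A false false * A true true - A false true * A true false

theorem cgTransform_mul_left (j : ℕ) (G : ℕ → Bool → ℂ) (c : ℂ) (p : Bool) (v : ℕ) :
    cgTransform j (fun u b => c * G u b) p v = c * cgTransform j G p v := by
  cases p <;> simp only [cgTransform] <;> ring

theorem cgTransform_congr {j : ℕ} {G H : ℕ → Bool → ℂ} (h : ∀ u b, G u b = H u b) (p : Bool)
    (v : ℕ) : cgTransform j G p v = cgTransform j H p v := by
  rw [show G = H from funext fun u => funext (h u)]

/-- The Clebsch–Gordan transform block-diagonalises `symPower A j ⊗ A`. -/
theorem cgTransform_symPower (A : Bool → Bool → ℂ) {j v v' : ℕ} {p p' : Bool}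
    (hv : v < j + 2 - 2 * p.toNat) (hv' : v' < j + 2 - 2 * p'.toNat) :
    cgTransform j (fun u b => cgTransform j (fun u' b' => symPower A j u u' * A b b') p' v') p v =
      if p = p' then detTwo A ^ p.toNat * symPower A (j + 1 - 2 * p.toNat) v v' else 0 := by
  have inner : ∀ u b, cgTransform j (fun u' b' => symPower A j u u' * A b b') p' v' =
      symNorm j u * cgTransform j
        (fun u' b' => symNorm j u' * (symCoeff A j u u' * A b b')) p' v' := by
    intro u b
    rw [← cgTransform_mul_left]
    exact cgTransform_congr (fun _ _ => by rw [symPower]; ring) _ _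
  rw [cgTransform_congr inner]
  cases p' with
  | false =>
    simp only [Bool.toNat_false, mul_zero, Nat.sub_zero] at hv'
    have i2 : ∀ (u : ℕ) b, cgTransform j
        (fun u' b' => symNorm j u' * (symCoeff A j u u' * A b b')) false v' =
        symNorm (j + 1) v' * (symCoeff A j u v' * A b false + symCoeff A j u (v' - 1) * A b true) := by
      intro u b
      exact cgTransform_false_symNorm (fun u' b' => symCoeff A j u u' * A b b')
        (fun _ => by rw [symCoeff_eq_zero_right _ _ _ _ (by omega)]; simp)
        (fun _ => by rw [symCoeff_eq_zero_right _ _ _ _ (by omega)]; simp) (by omega)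
    simp only [i2]
    cases p with
    | false =>
      simp only [Bool.toNat_false, mul_zero, Nat.sub_zero] at hv
      rw [cgTransform_false_symNorm (fun u b => symNorm (j + 1) v' *
        (symCoeff A j u v' * A b false + symCoeff A j u (v' - 1) * A b true))
        (fun _ => by simp [symCoeff_eq_zero]) (fun _ => by simp [symCoeff_eq_zero]) (by omega)]
      simp only [reduceIte, Bool.toNat_false, pow_zero, mul_zero, Nat.sub_zero, symPower, symCoeff]
      ring
    | true =>
      simp only [Bool.toNat_true] at hv
      obtain ⟨i, rfl⟩ : ∃ i, j = i + 1 := ⟨j - 1, by omega⟩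
      rw [cgTransform_true_symNorm (fun u b => symNorm (i + 1 + 1) v' *
        (symCoeff A (i + 1) u v' * A b false + symCoeff A (i + 1) u (v' - 1) * A b true))
        (by omega)]
      rw [if_neg (by simp)]
      -- Up to a factor, Bob's component is `g_b = F^j ∂F/∂x_b`, a gradient; so the curl `∂g₀/∂x₁ -
      -- ∂g₁/∂x₀` vanishes. The other mixed case is the same with the parties exchanged.
      have a1 := mul_symCoeff_succ A i (v + 1) v'
      have a2 := mul_symCoeff_succ A i (v + 1) (v' - 1)
      have a3 := sub_mul_symCoeff_succ A i v v'
      have a4 := sub_mul_symCoeff_succ A i v (v' - 1)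
      push_cast at a1 a2 a3 a4
      rw [add_sub_cancel_right] at a1 a2
      apply mul_eq_zero_of_right
      linear_combination (symNorm (i + 1 + 1) v' : ℂ) * (A false false * a1 + A false true * a2
        - A true false * a3 - A true true * a4)
  | true =>
    simp only [Bool.toNat_true] at hv'
    obtain ⟨i, rfl⟩ : ∃ i, j = i + 1 := ⟨j - 1, by omega⟩
    have i2 : ∀ (u : ℕ) b, cgTransform (i + 1)
        (fun u' b' => symNorm (i + 1) u' * (symCoeff A (i + 1) u u' * A b b')) true v' =
        (symNorm i v' : ℂ) * (1 / Real.sqrt ((i + 1) * (i + 2)) : ℝ) *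
        ((v' + 1) * (symCoeff A (i + 1) u (v' + 1) * A b false) -
          (i + 1 - v') * (symCoeff A (i + 1) u v' * A b true)) := by
      intro u b
      exact cgTransform_true_symNorm (fun u' b' => symCoeff A (i + 1) u u' * A b b') (by omega)
    simp only [i2]
    cases p with
    | false =>
      simp only [Bool.toNat_false, mul_zero, Nat.sub_zero] at hv
      rw [cgTransform_false_symNorm (fun u b =>
        (symNorm i v' : ℂ) * (1 / Real.sqrt ((i + 1) * (i + 2)) : ℝ) *
        ((v' + 1) * (symCoeff A (i + 1) u (v' + 1) * A b false) -
          (i + 1 - v') * (symCoeff A (i + 1) u v' * A b true)))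
        (fun _ => by simp [symCoeff_eq_zero])
        (fun _ => by
          rw [symCoeff_eq_zero A (i + 1) _ _ (by push_cast; omega),
            symCoeff_eq_zero A (i + 1) _ _ (by push_cast; omega)]; simp) (by omega)]
      rw [if_neg (by simp)]
      have a1 := mul_symCoeff_succ_right A i v (v' + 1)
      have a2 := mul_symCoeff_succ_right A i (v - 1) (v' + 1)
      have a3 := sub_mul_symCoeff_succ_right A i v v'
      have a4 := sub_mul_symCoeff_succ_right A i (v - 1) v'
      push_cast at a1 a2 a3 a4
      rw [add_sub_cancel_right] at a1 a2
      apply mul_eq_zero_of_right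
      linear_combination (symNorm i v' : ℂ) * (1 / Real.sqrt ((i + 1) * (i + 2)) : ℝ) *
        (A false false * a1 + A true false * a2 - A false true * a3 - A true true * a4)
    | true =>
      simp only [Bool.toNat_true] at hv
      rw [cgTransform_true_symNorm (fun u b =>
        (symNorm i v' : ℂ) * (1 / Real.sqrt ((i + 1) * (i + 2)) : ℝ) *
        ((v' + 1) * (symCoeff A (i + 1) u (v' + 1) * A b false) -
          (i + 1 - v') * (symCoeff A (i + 1) u v' * A b true))) (by omega)]
      simp only [reduceIte, Bool.toNat_true, pow_one, mul_one, show i + 1 + 1 - 2 = i by omega,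
        symPower, detTwo]
      -- This is Cayley's identity: the operator `A₀₀ ∂x₁∂y₁ - A₀₁ ∂x₁∂y₀ - A₁₀ ∂x₀∂y₁ + A₁₁ ∂x₀∂y₀`
      -- maps `F^(i+1)` to `(i+1)(i+2) det(A) F^i`. The factor cancels against the two normalizing
      -- constants `r`.
      have a1 := mul_symCoeff_succ A i (v + 1) (v' + 1)
      have a2 := mul_symCoeff_succ A i (v + 1) v'
      have a3 := sub_mul_symCoeff_succ A i v (v' + 1)
      have a4 := sub_mul_symCoeff_succ A i v v'
      push_cast at a1 a2 a3 a4
      rw [add_sub_cancel_right] at a1 a2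
      rw [add_sub_cancel_right] at a1 a3
      have hr : ((1 / Real.sqrt ((i + 1) * (i + 2)) : ℝ) : ℂ) ^ 2 * ((i + 1) * (i + 2)) = 1 := by
        have : (1 / Real.sqrt ((i + 1) * (i + 2))) ^ 2 * (((i : ℝ) + 1) * (i + 2)) = 1 := by
          rw [div_pow, Real.sq_sqrt (by positivity)]
          field_simp
        exact_mod_cast this
      generalize ((1 / Real.sqrt ((i + 1) * (i + 2)) : ℝ) : ℂ) = r at hr ⊢
      linear_combination (symNorm i v : ℂ) * symNorm i v' * r ^ 2 *
        ((v' + 1) * A false false * a1 - (i + 1 - v') * A false true * a2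
          - (v' + 1) * A true false * a3 + (i + 1 - v') * A true true * a4) +
        (symNorm i v : ℂ) * symNorm i v' * symCoeff A i v v' *
          (A false false * A true true - A false true * A true false) * hr

/-- The squared Frobenius norm of the symmetric power. -/
noncomputable def symPowerNormSq (A : Bool → Bool → ℂ) (j : ℕ) : ℝ :=
  ∑ u ∈ Finset.range (j + 1), ∑ v ∈ Finset.range (j + 1), ‖symPower A j u v‖ ^ 2

theorem symPowerNormSq_zero (A : Bool → Bool → ℂ) : symPowerNormSq A 0 = 1 := by
  simp [symPowerNormSq, symPower, symCoeff, symNorm]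

/-- The transform preserves the norm in each of the two indices of `symPower A j ⊗ A`, and the
off-diagonal blocks vanish by `cgTransform_symPower`. The resulting recursion for the norms is that
of the complete homogeneous symmetric polynomials. -/
theorem sum_norm_cgTransform_symPower (A : Bool → Bool → ℂ) (j : ℕ) :
    ∑ p : Bool, ∑ v ∈ Finset.range (j + 2 - 2 * p.toNat),
      ∑ v' ∈ Finset.range (j + 2 - 2 * p.toNat),
        ‖detTwo A ^ p.toNat * symPower A (j + 1 - 2 * p.toNat) v v'‖ ^ 2 =
      symPowerNormSq A j * ∑ b, ∑ c, ‖A b c‖ ^ 2 := by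
  have h1 : ∀ u b, ∑ b' : Bool, ∑ u' ∈ Finset.range (j + 1), ‖symPower A j u u' * A b b'‖ ^ 2 =
      _ := fun u b => (sum_norm_cgTransform_sq j fun u' b' => symPower A j u u' * A b b').symm
  have h2 : ∑ b : Bool, ∑ u ∈ Finset.range (j + 1), ∑ b' : Bool, ∑ u' ∈ Finset.range (j + 1),
      ‖symPower A j u u' * A b b'‖ ^ 2 = symPowerNormSq A j * ∑ b, ∑ c, ‖A b c‖ ^ 2 := by
    simp only [symPowerNormSq, norm_mul, mul_pow, Finset.mul_sum, Finset.sum_mul]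
    refine Finset.sum_congr rfl fun b _ => ?_
    rw [Finset.sum_comm]
  rw [← h2]
  simp only [h1]
  have h3 : ∀ p' v', ∑ b : Bool, ∑ u ∈ Finset.range (j + 1),
      ‖cgTransform j (fun u' b' => symPower A j u u' * A b b') p' v'‖ ^ 2 = _ := fun p' v' =>
    (sum_norm_cgTransform_sq j fun u b =>
      cgTransform j (fun u' b' => symPower A j u u' * A b b') p' v').symm
  have h4 : ∑ b : Bool, ∑ u ∈ Finset.range (j + 1), ∑ p' : Bool,
      ∑ v' ∈ Finset.range (j + 2 - 2 * p'.toNat),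
      ‖cgTransform j (fun u' b' => symPower A j u u' * A b b') p' v'‖ ^ 2 =
      ∑ p' : Bool, ∑ v' ∈ Finset.range (j + 2 - 2 * p'.toNat), ∑ b : Bool,
        ∑ u ∈ Finset.range (j + 1),
        ‖cgTransform j (fun u' b' => symPower A j u u' * A b b') p' v'‖ ^ 2 := by
    calc _ = ∑ b : Bool, ∑ p' : Bool, ∑ v' ∈ Finset.range (j + 2 - 2 * p'.toNat),
          ∑ u ∈ Finset.range (j + 1),
          ‖cgTransform j (fun u' b' => symPower A j u u' * A b b') p' v'‖ ^ 2 := by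
          refine Finset.sum_congr rfl fun b _ => ?_
          rw [Finset.sum_comm]
          exact Finset.sum_congr rfl fun p' _ => Finset.sum_comm
      _ = _ := by
          rw [Finset.sum_comm]
          exact Finset.sum_congr rfl fun p' _ => Finset.sum_comm
  rw [h4]
  simp only [h3]
  rw [eq_comm]
  refine Finset.sum_congr rfl fun p' _ => ?_
  rw [Finset.sum_comm' (t' := Finset.range (j + 2 - 2 * p'.toNat))
    (s' := fun _ => Finset.range (j + 2 - 2 * p'.toNat)) (by simp)]
  refine Finset.sum_congr rfl fun v' hv' => ?_
  rw [Finset.sum_eq_single p']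
  · refine Finset.sum_congr rfl fun v hv => ?_
    rw [cgTransform_symPower A (Finset.mem_range.1 hv) (Finset.mem_range.1 hv'), if_pos rfl]
  · intro p _ hp
    refine Finset.sum_eq_zero fun v hv => ?_
    rw [cgTransform_symPower A (Finset.mem_range.1 hv) (Finset.mem_range.1 hv'), if_neg hp]
    simp
  · simp

theorem symPowerNormSq_one (A : Bool → Bool → ℂ) :
    symPowerNormSq A 1 = ∑ b, ∑ c, ‖A b c‖ ^ 2 := by
  have h := sum_norm_cgTransform_symPower A 0
  rw [symPowerNormSq_zero, one_mul] at h
  rw [← h]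
  simp [symPowerNormSq]

theorem symPowerNormSq_add_two (A : Bool → Bool → ℂ) (j : ℕ) :
    symPowerNormSq A (j + 2) = symPowerNormSq A (j + 1) * (∑ b, ∑ c, ‖A b c‖ ^ 2) -
      ‖detTwo A‖ ^ 2 * symPowerNormSq A j := by
  rw [← sum_norm_cgTransform_symPower A (j + 1)]
  simp [symPowerNormSq, Finset.mul_sum, mul_pow]

/-- The squared Frobenius norm of the symmetric power in terms of the eigenvalues `x` and `y` of
`A * Aᴴ`. -/
theorem symPowerNormSq_eq (A : Bool → Bool → ℂ) {x y : ℝ}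
    (hs : ∑ b, ∑ c, ‖A b c‖ ^ 2 = x + y) (hd : ‖detTwo A‖ ^ 2 = x * y) (j : ℕ) :
    symPowerNormSq A j = ∑ u ∈ Finset.range (j + 1), x ^ (j - u) * y ^ u := by
  have main : ∀ j, symPowerNormSq A j = ∑ u ∈ Finset.range (j + 1), x ^ (j - u) * y ^ u ∧
      symPowerNormSq A (j + 1) = ∑ u ∈ Finset.range (j + 2), x ^ (j + 1 - u) * y ^ u := by
    intro j
    induction j with
    | zero =>
      rw [symPowerNormSq_zero, symPowerNormSq_one, hs]
      simp [Finset.sum_range_succ]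
    | succ j ih =>
      refine ⟨ih.2, ?_⟩
      rw [symPowerNormSq_add_two, hs, hd, ih.1, ih.2]
      have r : ∀ k, ∑ u ∈ Finset.range (k + 2), x ^ (k + 1 - u) * y ^ u =
          x * (∑ u ∈ Finset.range (k + 1), x ^ (k - u) * y ^ u) + y ^ (k + 1) := by
        intro k
        rw [Finset.sum_range_succ, Finset.mul_sum]
        congr 1
        · refine Finset.sum_congr rfl fun u hu => ?_
          rw [Nat.succ_sub (by simp at hu; omega), pow_succ]
          ring
        · simp
      rw [show j + 1 + 1 = (j + 1) + 1 by ring, r (j + 1), r j]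
      ring
  exact (main j).1

/-! ### Lengths of words -/

/-- The total length of the words that belong to a node of size `d`. -/
noncomputable def wordsLength (d : ℕ) : ℝ := ∑ w ∈ words d, (w.length : ℝ)

theorem wordsLength_nonneg (d : ℕ) : 0 ≤ wordsLength d :=
  Finset.sum_nonneg fun _ _ => Nat.cast_nonneg _

theorem wordsLength_le (d : ℕ) : wordsLength d * Real.log 2 ≤ d * Real.log d := by
  rw [wordsLength, Finset.sum_mul]
  calc _ ≤ ∑ w ∈ words d, Real.log d := by
        refine Finset.sum_le_sum fun w hw => ?_
        have h := Nat.ge_two_pow_of_testBit (mem_words.1 hw)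
        rw [← Real.log_pow]
        exact Real.log_le_log (by positivity) (by exact_mod_cast h)
    _ = _ := by rw [Finset.sum_const, card_words, nsmul_eq_mul]

theorem sum_two_pow_mul_sub (m : ℕ) :
    ∑ l ∈ Finset.range (m + 1), (2 : ℝ) ^ l * (m - l) = 2 ^ (m + 1) - m - 2 := by
  induction m with
  | zero => simp
  | succ m ih =>
    rw [Finset.sum_range_succ']
    have : ∀ l ∈ Finset.range (m + 1),
        (2 : ℝ) ^ (l + 1) * ((m + 1 : ℕ) - (l + 1 : ℕ)) = 2 * (2 ^ l * (m - l)) := by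
      intro l _; push_cast; ring
    rw [Finset.sum_congr rfl this, ← Finset.mul_sum, ih]
    push_cast; ring

/-- With `m = ⌊log₂ d⌋`, a word is shorter than `m` by 2 on average at most, since long words
dominate in number; replacing `m` by `log₂ d` costs at most 1 more. -/
theorem le_wordsLength (d : ℕ) :
    d * Real.log d - 3 * Real.log 2 * d ≤ wordsLength d * Real.log 2 := by
  rcases Nat.eq_zero_or_pos d with rfl | hd
  · simp [wordsLength, words]
  have hlog : 0 < Real.log 2 := Real.log_pos (by norm_num)
  set m := Nat.log 2 d with hm
  have h1 : 2 ^ m ≤ d := Nat.pow_log_le_self 2 hd.ne'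
  have h2 : d < 2 ^ (m + 1) := Nat.lt_pow_succ_log_self (by norm_num) d
  have h3 : Real.log d ≤ (m + 1) * Real.log 2 := by
    have : Real.log d ≤ Real.log (2 ^ (m + 1)) :=
      Real.log_le_log (by exact_mod_cast hd) (by exact_mod_cast h2.le)
    rw [Real.log_pow] at this
    exact_mod_cast this
  -- The deficit is bounded by including every position up to `m`, whether or not its bit is set.
  have h4 : ∑ w ∈ words d, ((m : ℝ) - w.length) ≤ 2 * d := by
    rw [sum_words d fun l => (m : ℝ) - l]
    calc _ ≤ ∑ l ∈ Finset.range (m + 1), (2 : ℝ) ^ l * (m - l) := by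
          simp only [nsmul_eq_mul, Nat.cast_pow, Nat.cast_ofNat]
          refine Finset.sum_le_sum_of_subset_of_nonneg ?_ ?_
          · intro l hl
            rw [Finset.mem_filter] at hl
            have := (Nat.ge_two_pow_of_testBit hl.2).trans_lt h2
            rw [Finset.mem_range]
            exact (Nat.pow_lt_pow_iff_right (by norm_num)).1 this
          · intro l hl _
            have : (l : ℝ) ≤ m := by
              exact_mod_cast Nat.lt_succ_iff.1 (Finset.mem_range.1 hl)
            exact mul_nonneg (by positivity) (by linarith)
      _ = 2 * 2 ^ m - m - 2 := by rw [sum_two_pow_mul_sub, pow_succ]; ring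
      _ ≤ 2 * d := by
          have : (2 : ℝ) ^ m ≤ d := by exact_mod_cast h1
          have : (0 : ℝ) ≤ m := Nat.cast_nonneg _
          linarith
  rw [Finset.sum_sub_distrib, Finset.sum_const, card_words, nsmul_eq_mul] at h4
  change d * (m : ℝ) - wordsLength d ≤ 2 * d at h4
  have h5 : d * Real.log d ≤ d * ((m + 1) * Real.log 2) :=
    mul_le_mul_of_nonneg_left h3 (Nat.cast_nonneg _)
  nlinarith

/-! ### Sums over the irreps -/

/-- The sum of `φ` over the number of ones, counted with the multiplicities of the irreps. -/
def diagramSum (N : ℕ) (φ : ℕ → ℝ) : ℝ :=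
  ∑ t ∈ Finset.range (N + 1), (youngDim N t : ℝ) * ∑ u ∈ Finset.range (N + 1 - 2 * t), φ (t + u)

/-- This is Pascal's rule for the numbers of ones. A node with irrep dimension `D + 1` contributes
to irreps of dimensions `D + 2` and `D`, whose weights together are those of the old irrep tensored
with a qubit. -/
theorem diagramSum_succ (N : ℕ) (φ : ℕ → ℝ) :
    diagramSum (N + 1) φ = diagramSum N fun k => φ k + φ (k + 1) := by
  have h1 : diagramSum (N + 1) φ = ∑ t ∈ Finset.range (N + 2),
      (youngDim N t : ℝ) * ∑ u ∈ Finset.range (N + 2 - 2 * t), φ (t + u) +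
      ∑ t ∈ Finset.range (N + 2),
      (youngDimPred N t : ℝ) * ∑ u ∈ Finset.range (N + 2 - 2 * t), φ (t + u) := by
    rw [diagramSum, ← Finset.sum_add_distrib]
    refine Finset.sum_congr rfl fun t _ => ?_
    by_cases h : 2 * t ≤ N + 1
    · rw [youngDim_succ h]; push_cast; ring
    · rw [show N + 1 + 1 - 2 * t = 0 by omega]; simp
  rw [h1, Finset.sum_range_succ, youngDim_eq_zero (show N < 2 * (N + 1) by omega),
    Finset.sum_range_succ' (fun t => (youngDimPred N t : ℝ) * _)]
  simp only [youngDimPred, Nat.cast_zero, zero_mul, add_zero]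
  rw [diagramSum, ← Finset.sum_add_distrib]
  refine Finset.sum_congr rfl fun t _ => ?_
  by_cases h : 2 * t ≤ N
  · obtain ⟨D, hD⟩ : ∃ D, N = 2 * t + D := ⟨N - 2 * t, by omega⟩
    subst hD
    rw [show 2 * t + D + 2 - 2 * t = D + 2 by omega,
      show 2 * t + D + 2 - 2 * (t + 1) = D by omega, show 2 * t + D + 1 - 2 * t = D + 1 by omega,
      Finset.sum_add_distrib, ← mul_add, Finset.sum_range_succ,
      Finset.sum_range_succ (fun u => φ (t + u + 1))]
    simp only [show ∀ u, t + 1 + u = t + u + 1 by intro u; ring]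
    rw [show t + (D + 1) = t + D + 1 by ring]
    ring
  · rw [youngDim_eq_zero (by omega)]; simp

theorem diagramSum_congr {N : ℕ} {φ χ : ℕ → ℝ} (h : ∀ k ≤ N, φ k = χ k) :
    diagramSum N φ = diagramSum N χ := by
  refine Finset.sum_congr rfl fun t _ => ?_
  congr 1
  refine Finset.sum_congr rfl fun u hu => h _ ?_
  rw [Finset.mem_range] at hu
  omega

theorem diagramSum_add (N : ℕ) (φ χ : ℕ → ℝ) :
    diagramSum N (fun k => φ k + χ k) = diagramSum N φ + diagramSum N χ := by
  simp only [diagramSum, Finset.sum_add_distrib, mul_add]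

theorem diagramSum_mul_left (N : ℕ) (φ : ℕ → ℝ) (c : ℝ) :
    diagramSum N (fun k => c * φ k) = c * diagramSum N φ := by
  simp only [diagramSum, ← Finset.mul_sum]
  rw [Finset.mul_sum]
  exact Finset.sum_congr rfl fun _ _ => by ring

theorem diagramSum_weight {x y : ℝ} (h : x + y = 1) (N : ℕ) :
    diagramSum N (fun k => x ^ (N - k) * y ^ k) = 1 := by
  induction N with
  | zero => simp [diagramSum, youngDim]
  | succ N ih =>
    rw [diagramSum_succ, ← ih]
    refine diagramSum_congr fun k hk => ?_
    rw [Nat.succ_sub hk, Nat.succ_sub_succ, pow_succ, pow_succ]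
    linear_combination x ^ (N - k) * y ^ k * h

/-- Linearity of expectation: each of the `N` independent symbols contributes `x * a + y * b`. -/
theorem diagramSum_weight_mul {x y : ℝ} (h : x + y = 1) (a b : ℝ) (N : ℕ) :
    diagramSum N (fun k => x ^ (N - k) * y ^ k * (((N - k : ℕ) : ℝ) * a + k * b)) =
      N * (x * a + y * b) := by
  induction N with
  | zero => simp [diagramSum, youngDim]
  | succ N ih =>
    have : N * (x * a + y * b) + (x * a + y * b) = ((N + 1 : ℕ) : ℝ) * (x * a + y * b) := by
      push_cast; ring
    rw [diagramSum_succ, ← this, ← ih]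
    conv_rhs => rw [← mul_one (x * a + y * b), ← diagramSum_weight h N, ← diagramSum_mul_left,
      ← diagramSum_add]
    refine diagramSum_congr fun k hk => ?_
    rw [Nat.succ_sub hk, Nat.succ_sub_succ, pow_succ, pow_succ]
    push_cast
    linear_combination x ^ (N - k) * y ^ k * (((N - k : ℕ) : ℝ) * a + k * b) * h

/-! ### Entropy of the spectrum against the mean logarithm of the multiplicities -/

theorem negMulLog_weight (x y : ℝ) (m k : ℕ) :
    Real.negMulLog (x ^ m * y ^ k) =
      x ^ m * y ^ k * ((m : ℝ) * (-Real.log x) + k * (-Real.log y)) := by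
  rw [Real.negMulLog]
  rcases eq_or_ne (x ^ m) 0 with h1 | h1
  · simp [h1]
  rcases eq_or_ne (y ^ k) 0 with h2 | h2
  · simp [h2]
  rw [Real.log_mul h1 h2, Real.log_pow, Real.log_pow]
  ring

theorem diagramSum_negMulLog {x y : ℝ} (h : x + y = 1) (N : ℕ) :
    diagramSum N (fun k => Real.negMulLog (x ^ (N - k) * y ^ k)) =
      N * (Real.negMulLog x + Real.negMulLog y) := by
  simp only [negMulLog_weight]
  rw [diagramSum_weight_mul h]
  simp only [Real.negMulLog]
  ring

/-- The expected yield in terms of the eigenvalues of the reduced state. -/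
noncomputable def spectralYield (x y : ℝ) (N : ℕ) : ℝ :=
  ∑ t ∈ Finset.range (N + 1), wordsLength (youngDim N t) *
    ∑ u ∈ Finset.range (N + 1 - 2 * t), x ^ (N - (t + u)) * y ^ (t + u)

theorem spectralYield_nonneg {x y : ℝ} (hx : 0 ≤ x) (hy : 0 ≤ y) (N : ℕ) :
    0 ≤ spectralYield x y N :=
  Finset.sum_nonneg fun _ _ => mul_nonneg (wordsLength_nonneg _)
    (Finset.sum_nonneg fun _ _ => by positivity)

/-- The expectation of the logarithm of the multiplicity. -/
noncomputable def logDimSum (x y : ℝ) (N : ℕ) : ℝ :=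
  ∑ t ∈ Finset.range (N + 1), (youngDim N t : ℝ) * Real.log (youngDim N t) *
    ∑ u ∈ Finset.range (N + 1 - 2 * t), x ^ (N - (t + u)) * y ^ (t + u)

theorem spectralYield_le_logDimSum {x y : ℝ} (hx : 0 ≤ x) (hy : 0 ≤ y) (N : ℕ) :
    spectralYield x y N * Real.log 2 ≤ logDimSum x y N := by
  rw [spectralYield, Finset.sum_mul]
  refine Finset.sum_le_sum fun t _ => ?_
  rw [mul_right_comm]
  exact mul_le_mul_of_nonneg_right (wordsLength_le _) (Finset.sum_nonneg fun _ _ => by positivity)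

theorem logDimSum_le_spectralYield {x y : ℝ} (hx : 0 ≤ x) (hy : 0 ≤ y) (h : x + y = 1) (N : ℕ) :
    logDimSum x y N - 3 * Real.log 2 ≤ spectralYield x y N * Real.log 2 := by
  have e : 3 * Real.log 2 = 3 * Real.log 2 * diagramSum N (fun k => x ^ (N - k) * y ^ k) := by
    rw [diagramSum_weight h, mul_one]
  rw [e, logDimSum, diagramSum, Finset.mul_sum, ← Finset.sum_sub_distrib, spectralYield,
    Finset.sum_mul]
  refine Finset.sum_le_sum fun t _ => ?_
  rw [mul_right_comm (wordsLength _), ← mul_assoc, ← sub_mul]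
  exact mul_le_mul_of_nonneg_right (le_wordsLength _) (Finset.sum_nonneg fun _ _ => by positivity)

theorem youngDim_mul_weight_le {x y : ℝ} (hx : 0 ≤ x) (hy : 0 ≤ y) (h : x + y = 1) {N t u : ℕ}
    (ht : t < N + 1) (hu : u < N + 1 - 2 * t) :
    (youngDim N t : ℝ) * (x ^ (N - (t + u)) * y ^ (t + u)) ≤ 1 := by
  rw [← diagramSum_weight h N, diagramSum]
  refine le_trans ?_ (Finset.single_le_sum (f := fun t => (youngDim N t : ℝ) *
    ∑ u ∈ Finset.range (N + 1 - 2 * t), x ^ (N - (t + u)) * y ^ (t + u))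
    (fun t _ => mul_nonneg (Nat.cast_nonneg _) (Finset.sum_nonneg fun _ _ => by positivity))
    (Finset.mem_range.2 ht))
  refine mul_le_mul_of_nonneg_left ?_ (Nat.cast_nonneg _)
  exact Finset.single_le_sum (f := fun u => x ^ (N - (t + u)) * y ^ (t + u))
    (fun _ _ => by positivity) (Finset.mem_range.2 hu)

/-- An eigenvalue `L` of multiplicity at least `d` satisfies `d * L ≤ 1`, so `log d ≤ -log L`;
averaging gives the entropy. -/
theorem logDimSum_le {x y : ℝ} (hx : 0 ≤ x) (hy : 0 ≤ y) (h : x + y = 1) (N : ℕ) :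
    logDimSum x y N ≤ N * (Real.negMulLog x + Real.negMulLog y) := by
  rw [← diagramSum_negMulLog h, logDimSum, diagramSum]
  refine Finset.sum_le_sum fun t ht => ?_
  rw [mul_assoc]
  rcases Nat.eq_zero_or_pos (youngDim N t) with h0 | h0
  · simp [h0]
  replace h0 : (0 : ℝ) < youngDim N t := by exact_mod_cast h0
  refine mul_le_mul_of_nonneg_left ?_ h0.le
  rw [Finset.mul_sum]
  refine Finset.sum_le_sum fun u hu => ?_
  have h1 := youngDim_mul_weight_le hx hy h (Finset.mem_range.1 ht) (Finset.mem_range.1 hu)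
  have hL : 0 ≤ x ^ (N - (t + u)) * y ^ (t + u) := by positivity
  generalize x ^ (N - (t + u)) * y ^ (t + u) = L at h1 hL ⊢
  rcases hL.eq_or_lt with rfl | hL
  · simp
  have := Real.log_nonpos (mul_pos h0 hL).le h1
  rw [Real.log_mul h0.ne' hL.ne'] at this
  rw [Real.negMulLog]
  nlinarith

/-- The tangent bound `log z ≤ z - 1` at `z = 1 / (M * q)`. Summed over a distribution on at most
`M` points, it bounds the entropy by `log M`. -/
theorem negMulLog_le {q M : ℝ} (hq : 0 ≤ q) (hM : 0 < M) :
    Real.negMulLog q ≤ q * Real.log M + 1 / M - q := by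
  rcases hq.eq_or_lt with rfl | hq
  · simp; positivity
  have h := Real.log_le_sub_one_of_pos (show 0 < 1 / (M * q) by positivity)
  rw [Real.log_div one_ne_zero (by positivity), Real.log_one, Real.log_mul hM.ne' hq.ne'] at h
  have h2 := mul_le_mul_of_nonneg_left h hq.le
  have e : q * (1 / (M * q) - 1) = 1 / M - q := by field_simp
  rw [e] at h2
  rw [Real.negMulLog]
  linarith

/-- The gap is the entropy of the pair `(t, u)`, whose probabilities are `d * L`; there are at most
`(N + 1) ^ 2` pairs. -/
theorem le_logDimSum {x y : ℝ} (hx : 0 ≤ x) (hy : 0 ≤ y) (h : x + y = 1) (N : ℕ) :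
    N * (Real.negMulLog x + Real.negMulLog y) - 2 * Real.log (N + 1) ≤ logDimSum x y N := by
  have hM : (0 : ℝ) < (N + 1) * (N + 1) := by positivity
  set M : ℝ := (N + 1) * (N + 1) with hMdef
  have hlogM : Real.log M = 2 * Real.log (N + 1) := by
    rw [hMdef, Real.log_mul (by positivity) (by positivity)]; ring
  have key : ∀ t u : ℕ, (youngDim N t : ℝ) * Real.negMulLog (x ^ (N - (t + u)) * y ^ (t + u)) ≤
      youngDim N t * Real.log (youngDim N t) * (x ^ (N - (t + u)) * y ^ (t + u)) +
      (Real.log M - 1) * (youngDim N t * (x ^ (N - (t + u)) * y ^ (t + u))) + 1 / M := by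
    intro t u
    have hL : 0 ≤ x ^ (N - (t + u)) * y ^ (t + u) := by positivity
    generalize x ^ (N - (t + u)) * y ^ (t + u) = L at hL ⊢
    have hd : (0 : ℝ) ≤ youngDim N t := Nat.cast_nonneg _
    generalize (youngDim N t : ℝ) = d at hd ⊢
    have h1 := negMulLog_le (mul_nonneg hd hL) hM
    rw [Real.negMulLog_mul] at h1
    simp only [Real.negMulLog] at h1 ⊢
    linarith
  have total := diagramSum_weight h N
  rw [diagramSum] at total
  rw [← diagramSum_negMulLog h, logDimSum, diagramSum]
  have h2 : ∑ t ∈ Finset.range (N + 1), (youngDim N t : ℝ) *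
      ∑ u ∈ Finset.range (N + 1 - 2 * t), Real.negMulLog (x ^ (N - (t + u)) * y ^ (t + u)) ≤
      ∑ t ∈ Finset.range (N + 1), (youngDim N t * Real.log (youngDim N t) *
        ∑ u ∈ Finset.range (N + 1 - 2 * t), x ^ (N - (t + u)) * y ^ (t + u) +
      (Real.log M - 1) * (youngDim N t *
        ∑ u ∈ Finset.range (N + 1 - 2 * t), x ^ (N - (t + u)) * y ^ (t + u)) +
      ∑ u ∈ Finset.range (N + 1 - 2 * t), 1 / M) := by
    refine Finset.sum_le_sum fun t _ => ?_
    simp only [Finset.mul_sum]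
    rw [← Finset.sum_add_distrib, ← Finset.sum_add_distrib]
    exact Finset.sum_le_sum fun u _ => key t u
  rw [Finset.sum_add_distrib, Finset.sum_add_distrib, ← Finset.mul_sum, total] at h2
  have h3 : ∑ t ∈ Finset.range (N + 1), ∑ u ∈ Finset.range (N + 1 - 2 * t), 1 / M ≤ 1 := by
    calc _ ≤ ∑ t ∈ Finset.range (N + 1), ∑ u ∈ Finset.range (N + 1), 1 / M := by
          refine Finset.sum_le_sum fun t _ => ?_
          refine Finset.sum_le_sum_of_subset_of_nonneg ?_ fun _ _ _ => by positivity
          exact Finset.range_subset_range.2 (by omega)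
      _ = 1 := by
          simp only [Finset.sum_const, Finset.card_range, nsmul_eq_mul, hMdef]
          push_cast
          field_simp
  rw [hlogM] at h2
  linarith

/-- The entropy, to base 2, of a distribution on two points. -/
noncomputable def binaryEntropy (x y : ℝ) : ℝ :=
  (Real.negMulLog x + Real.negMulLog y) / Real.log 2

theorem spectralYield_le {x y : ℝ} (hx : 0 ≤ x) (hy : 0 ≤ y) (h : x + y = 1) (N : ℕ) :
    spectralYield x y N ≤ N * binaryEntropy x y := by
  have hlog : 0 < Real.log 2 := Real.log_pos (by norm_num)
  rw [binaryEntropy, mul_div_assoc', le_div_iff₀ hlog]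
  exact (spectralYield_le_logDimSum hx hy N).trans (logDimSum_le hx hy h N)

/-- The constant 5 is 2 for the labels plus 3 for the word lengths, where `log 2 ≤ log (N + 1)` is
used for `N ≥ 1`. -/
theorem le_spectralYield {x y : ℝ} (hx : 0 ≤ x) (hy : 0 ≤ y) (h : x + y = 1) (N : ℕ) :
    N * binaryEntropy x y - 5 / Real.log 2 * Real.log (N + 1) ≤ spectralYield x y N := by
  have hlog : 0 < Real.log 2 := Real.log_pos (by norm_num)
  rcases Nat.eq_zero_or_pos N with rfl | hN
  · simpa using spectralYield_nonneg hx hy 0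
  have h1 := le_logDimSum hx hy h N
  have h2 := logDimSum_le_spectralYield hx hy h N
  have h3 : Real.log 2 ≤ Real.log (N + 1) := by
    refine Real.log_le_log (by norm_num) ?_
    have : (1 : ℝ) ≤ N := by exact_mod_cast hN
    linarith
  have e : N * binaryEntropy x y - 5 / Real.log 2 * Real.log (N + 1) =
      (N * (Real.negMulLog x + Real.negMulLog y) - 5 * Real.log (N + 1)) / Real.log 2 := by
    rw [binaryEntropy]; field_simp
  rw [e, div_le_iff₀ hlog]
  linarith

/-- A yield that is at most logarithmically smaller than ideal has at most a logarithmic lag. -/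
theorem exists_lag {E C : ℝ} {Y : ℕ → ℝ} (hE : 0 ≤ E) (hC : 0 ≤ C) (hY : ∀ N, 0 ≤ Y N)
    (h : ∀ N : ℕ, N * E - C * Real.log (N + 1) ≤ Y N) :
    ∃ K : ℝ, ∀ N : ℕ, ∃ k : ℕ, (k : ℝ) ≤ K * Real.log (N + 1) ∧ N * E ≤ Y (N + k) := by
  rcases hE.eq_or_lt with rfl | hE
  · exact ⟨0, fun N => ⟨0, by simp, by simpa using hY _⟩⟩
  have hlog : 0 < Real.log 2 := Real.log_pos (by norm_num)
  -- This makes `C / a ≤ E / 2`: half of the gain `k * E` pays for the growth of the logarithm with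
  -- `k`.
  set a : ℝ := 2 * (C + 1) / E with ha
  have ha0 : 0 < a := by positivity
  obtain ⟨c, hc0, hc⟩ : ∃ c : ℝ, 0 ≤ c ∧ ∀ k : ℕ, Real.log (k + 1) ≤ k / a + c := by
    refine ⟨1 / a + |Real.log a|, by positivity, fun k => ?_⟩
    have h1 := Real.log_le_sub_one_of_pos (show 0 < ((k : ℝ) + 1) / a by positivity)
    rw [Real.log_div (by positivity) ha0.ne', add_div] at h1
    have := le_abs_self (Real.log a)
    linarith
  refine ⟨2 / E * C + (2 / E * (C * c) + 1) / Real.log 2, fun N => ?_⟩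
  rcases Nat.eq_zero_or_pos N with rfl | hN
  · exact ⟨0, by simp, by simpa using hY _⟩
  have h3 : Real.log 2 ≤ Real.log (N + 1) := by
    refine Real.log_le_log (by norm_num) ?_
    have : (1 : ℝ) ≤ N := by exact_mod_cast hN
    linarith
  set L := Real.log (N + 1) with hL
  have hL0 : 0 < L := hlog.trans_le h3
  have hz : 0 ≤ 2 / E * (C * L + C * c) := by positivity
  -- The other half of the gain, `E / 2 * k`, pays for the deficit `C * L + C * c`.
  refine ⟨⌈2 / E * (C * L + C * c)⌉₊, ?_, ?_⟩
  · have h4 := (Nat.ceil_lt_add_one hz).le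
    have h5 : (2 / E * (C * c) + 1) ≤ (2 / E * (C * c) + 1) / Real.log 2 * L := by
      rw [div_mul_eq_mul_div _ (Real.log 2), le_div_iff₀ hlog]
      exact mul_le_mul_of_nonneg_left h3 (by positivity)
    rw [add_mul]
    linarith
  · have h4 := Nat.le_ceil (2 / E * (C * L + C * c))
    generalize ⌈2 / E * (C * L + C * c)⌉₊ = k at h4 ⊢
    refine le_trans ?_ (h (N + k))
    have h5 : Real.log ((N + k : ℕ) + 1) ≤ L + (k / a + c) := by
      calc _ ≤ Real.log (((N : ℝ) + 1) * (k + 1)) := by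
            refine Real.log_le_log (by positivity) ?_
            push_cast
            have : (0 : ℝ) ≤ (N : ℝ) * k := by positivity
            linarith
        _ = L + Real.log (k + 1) := Real.log_mul (by positivity) (by positivity)
        _ ≤ _ := by linarith [hc k]
    have h6 : C * (k / a) ≤ E / 2 * k := by
      rw [ha]
      have : C * (k / (2 * (C + 1) / E)) = E / 2 * k * (C / (C + 1)) := by field_simp
      rw [this]
      refine mul_le_of_le_one_right (by positivity) ?_
      rw [div_le_one (by positivity)]
      linarith
    have h7 : C * L + C * c ≤ E / 2 * k := by
      have := mul_le_mul_of_nonneg_left h4 (show 0 ≤ E / 2 by positivity)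
      have e : E / 2 * (2 / E * (C * L + C * c)) = C * L + C * c := by field_simp
      linarith
    have h8 := mul_le_mul_of_nonneg_left h5 hC
    push_cast at h8 ⊢
    linarith

/-! ### Inner products of states -/

/-- The inner product of two states of a machine. -/
def stateInner (f g : State) : ℂ := f.sum fun x z => star z * g x

theorem stateInner_add_left (f f' g : State) :
    stateInner (f + f') g = stateInner f g + stateInner f' g :=
  Finsupp.sum_add_index' (by simp) (by intros; simp [add_mul])

theorem stateInner_smul_left (c : ℂ) (f g : State) :
    stateInner (c • f) g = star c * stateInner f g := by
  rw [stateInner, Finsupp.sum_smul_index (by simp), stateInner, Finsupp.mul_sum]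
  exact Finsupp.sum_congr fun x _ => by rw [star_mul']; ring

theorem stateInner_add_right (f g g' : State) :
    stateInner f (g + g') = stateInner f g + stateInner f g' := by
  simp only [stateInner, Finsupp.add_apply, mul_add]
  exact Finsupp.sum_add

theorem stateInner_smul_right (c : ℂ) (f g : State) :
    stateInner f (c • g) = c * stateInner f g := by
  simp only [stateInner, Finsupp.smul_apply, smul_eq_mul, Finsupp.mul_sum]
  exact Finsupp.sum_congr fun x _ => by ring

theorem stateInner_zero_left (g : State) : stateInner 0 g = 0 := Finsupp.sum_zero_index

theorem stateInner_zero_right (f : State) : stateInner f 0 = 0 := by simp [stateInner]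

theorem stateInner_single (x y : Conf) [Decidable (x = y)] :
    stateInner (Finsupp.single x 1) (Finsupp.single y 1) = if x = y then 1 else 0 := by
  classical
  rw [stateInner, Finsupp.sum_single_index (by simp), Finsupp.single_apply]
  simp [eq_comm]

/-! ### Protocols that interleave the Clebsch–Gordan and the streaming Elias transforms -/

/-- The configuration with registers `t`, `u` and output `w`. -/
def regConf (enc : ℕ × ℕ × ℕ → ℕ) (t u : ℕ) (w : List Bool) : Conf :=
  ⟨enc (t, u, w.length), false, w⟩

theorem regConf_inj {enc : ℕ × ℕ × ℕ → ℕ} (henc : Function.Injective enc) {t u t' u' : ℕ}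
    {w w' : List Bool} : regConf enc t u w = regConf enc t' u' w' ↔ t = t' ∧ u = u' ∧ w = w' := by
  constructor
  · intro h
    rw [regConf, regConf, Conf.mk.injEq] at h
    have h1 := henc h.1
    rw [Prod.mk.injEq, Prod.mk.injEq] at h1
    exact ⟨h1.1, h1.2.1, h.2.2⟩
  · rintro ⟨rfl, rfl, rfl⟩; rfl

/-- The action of one step on the basis states of the registers. -/
def StepRule (P : StreamingProtocol) (enc : ℕ × ℕ × ℕ → ℕ) : Prop :=
  ∀ n t u : ℕ, u < n + 1 - 2 * t → ∀ w ∈ words (youngDim n t), ∀ b : Bool,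
    P.step n b (Finsupp.single (regConf enc t u w) 1) =
      ∑ p : Bool, (cgCoeff (n - 2 * t) u b p : ℂ) •
        Finsupp.single (regConf enc (t + p.toNat) (cgTarget u b p)
          (eliasWord n (t + p.toNat) p w)) 1

theorem StreamingProtocol.InterleavesSchurElias.exists_stepRule {P : StreamingProtocol}
    (h : P.InterleavesSchurElias) :
    ∃ enc : ℕ × ℕ × ℕ → ℕ, Function.Injective enc ∧ enc (0, 0, 0) = 0 ∧ StepRule P enc := by
  obtain ⟨enc, h1, h2, h3⟩ := h
  refine ⟨enc, h1, h2, fun n t u hu w hw b => ?_⟩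
  rw [regConf, h3 n t u w.length (by omega) (by omega) (mem_words.1 hw) b w]
  refine Finset.sum_congr rfl fun p _ => ?_
  rw [Finsupp.smul_single, smul_eq_mul, mul_one, regConf, eliasWord_length]
  rfl

theorem cgTarget_lt {j u : ℕ} {b p : Bool} (hu : u ≤ j) (h : cgCoeff j u b p ≠ 0) :
    cgTarget u b p < j + 2 - 2 * p.toNat := by
  cases p with
  | false => cases b <;> simp [cgTarget] <;> omega
  | true =>
    cases b with
    | false =>
      rw [cgCoeff_false_true] at h
      have : u ≠ 0 := by
        rintro rfl
        exact h (cgOne_zero j)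
      simp [cgTarget]; omega
    | true =>
      rw [cgCoeff_true_true] at h
      have : u ≠ j := by
        rintro rfl
        simp [cgZero_last] at h
      simp [cgTarget]; omega

section

variable {P : StreamingProtocol} {enc : ℕ × ℕ × ℕ → ℕ}

/-- The basis states of the registers that occur after `N` inputs. -/
def regSet (enc : ℕ × ℕ × ℕ → ℕ) (N : ℕ) : Set Conf :=
  {x | ∃ t u w, u < N + 1 - 2 * t ∧ w ∈ words (youngDim N t) ∧ x = regConf enc t u w}

theorem step_mem_supported (hP : StepRule P enc) {N : ℕ} {f : State}
    (hf : f ∈ Finsupp.supported ℂ ℂ (regSet enc N)) (b : Bool) :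
    P.step N b f ∈ Finsupp.supported ℂ ℂ (regSet enc (N + 1)) := by
  rw [Finsupp.supported_eq_span_single] at hf
  induction hf using Submodule.span_induction with
  | zero => simp
  | add x y _ _ hx hy => rw [map_add]; exact add_mem hx hy
  | smul c x _ hx => rw [map_smul]; exact Submodule.smul_mem _ _ hx
  | mem x hx =>
    obtain ⟨_, ⟨t, u, w, hu, hw, rfl⟩, rfl⟩ := hx
    rw [hP N t u hu w hw b]
    refine Submodule.sum_mem _ fun p _ => ?_
    by_cases h : cgCoeff (N - 2 * t) u b p = 0
    · simp [h]
    · refine Submodule.smul_mem _ _ (Finsupp.single_mem_supported _ _ ?_)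
      have h1 := cgTarget_lt (by omega) h
      have h2 : p.toNat ≤ 1 := Bool.toNat_le p
      exact ⟨_, _, _, by omega, eliasWord_mem hw (by omega), rfl⟩

/-- Two branches of nonzero amplitude can meet only if they have the same `p`, `t` and `w`, by
`eliasWord_injective`. Within one such block the claim is `cgCoeff_orthonormal`. -/
theorem stateInner_step_single (henc : Function.Injective enc) (hP : StepRule P enc)
    {N t u t' u' : ℕ} {w w' : List Bool} (hu : u < N + 1 - 2 * t) (hu' : u' < N + 1 - 2 * t')
    (hw : w ∈ words (youngDim N t)) (hw' : w' ∈ words (youngDim N t')) (b b' : Bool) :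
    stateInner (P.step N b (Finsupp.single (regConf enc t u w) 1))
      (P.step N b' (Finsupp.single (regConf enc t' u' w') 1)) =
      if b = b' then stateInner (Finsupp.single (regConf enc t u w) 1)
        (Finsupp.single (regConf enc t' u' w') 1) else 0 := by
  classical
  have expand : ∀ (a c : Bool → ℝ) (X Y : Bool → Conf),
      stateInner (∑ p : Bool, (a p : ℂ) • Finsupp.single (X p) 1)
        (∑ p : Bool, (c p : ℂ) • Finsupp.single (Y p) 1) =
        ∑ p : Bool, ∑ q : Bool, if X p = Y q then ((a p * c q : ℝ) : ℂ) else 0 := by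
    intro a c X Y
    simp only [Fintype.sum_bool, stateInner_add_left, stateInner_add_right, stateInner_smul_left,
      stateInner_smul_right, stateInner_single, RCLike.star_def, Complex.conj_ofReal,
      Complex.ofReal_mul, mul_ite, mul_one, mul_zero]
    split_ifs <;> ring
  rw [hP N t u hu w hw b, hP N t' u' hu' w' hw' b', expand, stateInner_single, regConf_inj henc]
  have key : ∀ p q : Bool, regConf enc (t + p.toNat) (cgTarget u b p)
      (eliasWord N (t + p.toNat) p w) = regConf enc (t' + q.toNat) (cgTarget u' b' q)
      (eliasWord N (t' + q.toNat) q w') → cgCoeff (N - 2 * t) u b p ≠ 0 →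
      p = q ∧ t = t' ∧ w = w' := by
    intro p q h hne
    rw [regConf_inj henc] at h
    have h1 := cgTarget_lt (by omega) hne
    have h2 : p.toNat ≤ 1 := Bool.toNat_le p
    exact eliasWord_injective hw hw' (by omega) h.1 h.2.2
  by_cases hc : t = t' ∧ w = w'
  · obtain ⟨rfl, rfl⟩ := hc
    have h1 : ∀ p q : Bool, (if regConf enc (t + p.toNat) (cgTarget u b p)
      (eliasWord N (t + p.toNat) p w) = regConf enc (t + q.toNat) (cgTarget u' b' q)
      (eliasWord N (t + q.toNat) q w) then
        ((cgCoeff (N - 2 * t) u b p * cgCoeff (N - 2 * t) u' b' q : ℝ) : ℂ) else 0) =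
        if p = q then (((if cgTarget u b p = cgTarget u' b' p then
          cgCoeff (N - 2 * t) u b p * cgCoeff (N - 2 * t) u' b' p else 0) : ℝ) : ℂ) else 0 := by
      intro p q
      by_cases hpq : p = q
      · subst hpq
        simp only [regConf_inj henc, true_and, and_true, reduceIte]
        split_ifs <;> simp
      · rw [if_neg hpq]
        split_ifs with h
        · by_cases hz : cgCoeff (N - 2 * t) u b p = 0
          · simp [hz]
          · exact absurd (key p q h hz).1 hpq
        · rfl
    simp only [h1, Finset.sum_ite_eq, Finset.mem_univ, if_true]
    rw [← Complex.ofReal_sum, cgCoeff_orthonormal (by omega) (by omega)]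
    by_cases hb : b = b' <;> by_cases hu : u = u' <;> simp [hb, hu]
  · have h2 : ¬ (t = t' ∧ u = u' ∧ w = w') := fun h => hc ⟨h.1, h.2.2⟩
    rw [if_neg h2, ite_self]
    refine Finset.sum_eq_zero fun p _ => Finset.sum_eq_zero fun q _ => ?_
    split_ifs with h
    · by_cases hz : cgCoeff (N - 2 * t) u b p = 0
      · simp [hz]
      · exact absurd (key p q h hz).2 hc
    · rfl

theorem stateInner_step (henc : Function.Injective enc) (hP : StepRule P enc) {N : ℕ}
    {f g : State} (hf : f ∈ Finsupp.supported ℂ ℂ (regSet enc N))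
    (hg : g ∈ Finsupp.supported ℂ ℂ (regSet enc N)) (b b' : Bool) :
    stateInner (P.step N b f) (P.step N b' g) = if b = b' then stateInner f g else 0 := by
  rw [Finsupp.supported_eq_span_single] at hf hg
  induction hf using Submodule.span_induction with
  | zero => simp [stateInner_zero_left]
  | add x y _ _ hx hy =>
    rw [map_add, stateInner_add_left, hx, hy, stateInner_add_left]; split_ifs <;> simp
  | smul c x _ hx =>
    rw [map_smul, stateInner_smul_left, hx, stateInner_smul_left]; split_ifs <;> simp
  | mem x hx =>
    obtain ⟨_, ⟨t, u, w, hu, hw, rfl⟩, rfl⟩ := hx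
    induction hg using Submodule.span_induction with
    | zero => simp [stateInner_zero_right]
    | add x y _ _ hx hy =>
      rw [map_add, stateInner_add_right, hx, hy, stateInner_add_right]; split_ifs <;> simp
    | smul c x _ hx =>
      rw [map_smul, stateInner_smul_right, hx, stateInner_smul_right]; split_ifs <;> simp
    | mem x hx =>
      obtain ⟨_, ⟨t', u', w', hu', hw', rfl⟩, rfl⟩ := hx
      exact stateInner_step_single henc hP hu hu' hw hw' b b'

theorem nil_mem_words_one : [] ∈ words 1 := by rw [mem_words]; rfl

theorem run_mem_supported (h0 : enc (0, 0, 0) = 0) (hP : StepRule P enc) (N : ℕ)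
    (s : Fin N → Bool) : P.run N s ∈ Finsupp.supported ℂ ℂ (regSet enc N) := by
  induction N with
  | zero =>
    refine Finsupp.single_mem_supported _ _ ⟨0, 0, [], by omega, nil_mem_words_one, ?_⟩
    simp [regConf, h0]
  | succ N ih => exact step_mem_supported hP (ih _) _

theorem isReversible_of_stepRule (henc : Function.Injective enc) (h0 : enc (0, 0, 0) = 0)
    (hP : StepRule P enc) : P.IsReversible := by
  intro N
  constructor
  · induction N with
    | zero =>
      intro s t
      rw [if_pos (Subsingleton.elim s t)]
      classical exact (stateInner_single ⟨0, false, []⟩ ⟨0, false, []⟩).trans (if_pos rfl)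
    | succ N ih =>
      intro s t
      have h1 := stateInner_step henc hP (run_mem_supported h0 hP N (Fin.init s))
        (run_mem_supported h0 hP N (Fin.init t)) (s (Fin.last N)) (t (Fin.last N))
      refine h1.trans ?_
      rw [show stateInner (P.run N (Fin.init s)) (P.run N (Fin.init t)) = _ from ih _ _,
        ← ite_and]
      refine if_congr ?_ rfl rfl
      constructor
      · rintro ⟨h2, h3⟩
        rw [← Fin.snoc_init_self s, ← Fin.snoc_init_self t, h2, h3]
      · rintro rfl
        exact ⟨rfl, rfl⟩
  · intro s x hx
    have := (Finsupp.mem_supported _ _).1 (run_mem_supported h0 hP N s) hx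
    obtain ⟨t, u, w, -, hw, rfl⟩ := this
    exact ⟨rfl, le_of_testBit_youngDim (mem_words.1 hw)⟩

/-! ### The joint state -/

/-- The tensor product as a bilinear map. -/
noncomputable def tensorLin : State →ₗ[ℂ] State →ₗ[ℂ] (Conf × Conf →₀ ℂ) :=
  Finsupp.linearCombination ℂ fun x =>
    Finsupp.linearCombination ℂ fun y => Finsupp.single (x, y) (1 : ℂ)

theorem tensor_eq (f g : State) : tensor f g = tensorLin f g := by
  rw [tensorLin, Finsupp.linearCombination_apply, Finsupp.sum, LinearMap.sum_apply, tensor,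
    Finsupp.sum]
  refine Finset.sum_congr rfl fun x _ => ?_
  rw [LinearMap.smul_apply, Finsupp.linearCombination_apply, Finsupp.smul_sum]
  exact Finsupp.sum_congr fun y _ => by simp

theorem tensorLin_single (x y : Conf) :
    tensorLin (Finsupp.single x 1) (Finsupp.single y 1) = Finsupp.single (x, y) 1 := by
  simp [tensorLin]

/-- The action of two local operations. -/
noncomputable def localMap (S T : State →ₗ[ℂ] State) :
    (Conf × Conf →₀ ℂ) →ₗ[ℂ] (Conf × Conf →₀ ℂ) :=
  Finsupp.linearCombination ℂ fun z =>
    tensorLin (S (Finsupp.single z.1 1)) (T (Finsupp.single z.2 1))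

theorem localMap_single (S T : State →ₗ[ℂ] State) (x y : Conf) :
    localMap S T (Finsupp.single (x, y) 1) =
      tensorLin (S (Finsupp.single x 1)) (T (Finsupp.single y 1)) := by
  simp [localMap]

theorem localMap_tensorLin (S T : State →ₗ[ℂ] State) (f g : State) :
    localMap S T (tensorLin f g) = tensorLin (S f) (T g) := by
  induction f using Finsupp.induction_linear with
  | zero => simp
  | add f f' hf hf' => simp [hf, hf']
  | single x a =>
    induction g using Finsupp.induction_linear with
    | zero => simp
    | add g g' hg hg' => simp [hg, hg']
    | single y c =>
      rw [← mul_one a, ← mul_one c, ← smul_eq_mul, ← smul_eq_mul, ← Finsupp.smul_single,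
        ← Finsupp.smul_single]
      simp only [map_smul, LinearMap.smul_apply, tensorLin_single, localMap_single]

theorem jointState_succ (P : StreamingProtocol) (ψ : TwoQubit) (N : ℕ) :
    P.jointState ψ (N + 1) =
      ∑ b : Bool, ∑ c : Bool, ψ (b, c) •
        localMap (P.step N b) (P.step N c) (P.jointState ψ N) := by
  have e : ∀ {M : Type} [AddCommMonoid M] (F : (Fin (N + 1) → Bool) → M),
      ∑ s, F s = ∑ b : Bool, ∑ s : Fin N → Bool, F (Fin.snoc (α := fun _ => Bool) s b) := by
    intro M _ F
    rw [← (Fin.snocEquiv fun _ => Bool).sum_comp, Fintype.sum_prod_type]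
    rfl
  rw [StreamingProtocol.jointState, e]
  refine Finset.sum_congr rfl fun b _ => ?_
  simp_rw [e]
  rw [Finset.sum_comm]
  refine Finset.sum_congr rfl fun c _ => ?_
  rw [StreamingProtocol.jointState, map_sum, Finset.smul_sum]
  refine Finset.sum_congr rfl fun s _ => ?_
  rw [map_sum, Finset.smul_sum]
  refine Finset.sum_congr rfl fun t _ => ?_
  rw [map_smul, smul_smul, tensor_eq, tensor_eq, localMap_tensorLin, Fin.prod_univ_castSucc]
  simp only [StreamingProtocol.run, Fin.snoc_castSucc, Fin.snoc_last, Fin.init_snoc, mul_comm]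

/-- The coefficients of the joint state in the Schur basis. -/
noncomputable def blockCoeff (A : Bool → Bool → ℂ) (N t u u' : ℕ) : ℂ :=
  detTwo A ^ t * symPower A (N - 2 * t) u u'

/-- The part of the joint state that belongs to the Young diagram `(N, t)` and the output `w`. -/
noncomputable def blockState (enc : ℕ × ℕ × ℕ → ℕ) (A : Bool → Bool → ℂ) (N t : ℕ)
    (w : List Bool) : Conf × Conf →₀ ℂ :=
  ∑ u ∈ Finset.range (N + 1 - 2 * t), ∑ u' ∈ Finset.range (N + 1 - 2 * t),
    blockCoeff A N t u u' • Finsupp.single (regConf enc t u w, regConf enc t u' w) 1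

/-- Bob's transform acts on the second index of the block (`inner`), then Alice's on the first
(`outer`). Since `cgTransform_symPower` kills `p ≠ q`, both parties move to the same diagram and
append the same bits. -/
theorem localMap_blockState (hP : StepRule P enc) (A : Bool → Bool → ℂ) {N t : ℕ}
    {w : List Bool} (hw : w ∈ words (youngDim N t)) :
    ∑ b : Bool, ∑ c : Bool, A b c • localMap (P.step N b) (P.step N c) (blockState enc A N t w) =
      ∑ p : Bool, blockState enc A (N + 1) (t + p.toNat) (eliasWord N (t + p.toNat) p w) := by
  have ht : 2 * t ≤ N := by
    by_contra h
    rw [youngDim_eq_zero (by omega), mem_words] at hw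
    simp at hw
  obtain ⟨j, rfl⟩ : ∃ j, N = 2 * t + j := ⟨N - 2 * t, by omega⟩
  set S : Bool → ℕ → State := fun p v => Finsupp.single
    (regConf enc (t + p.toNat) v (eliasWord (2 * t + j) (t + p.toNat) p w)) 1 with hS
  have hj : 2 * t + j - 2 * t = j := by omega
  have hj1 : 2 * t + j + 1 - 2 * t = j + 1 := by omega
  have step : ∀ u < j + 1, ∀ b, P.step (2 * t + j) b (Finsupp.single (regConf enc t u w) 1) =
      ∑ p : Bool, (cgCoeff j u b p : ℂ) • S p (cgTarget u b p) := by
    intro u hu b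
    rw [hP _ t u (by omega) w hw b, hj]
  have inner : ∀ b u, ∑ c : Bool, ∑ u' ∈ Finset.range (j + 1), (A b c * symPower A j u u') •
      P.step (2 * t + j) c (Finsupp.single (regConf enc t u' w) 1) =
      ∑ q : Bool, ∑ v' ∈ Finset.range (j + 2 - 2 * q.toNat),
        cgTransform j (fun u' c => symPower A j u u' * A b c) q v' • S q v' := by
    intro b u
    rw [← sum_cgCoeff_smul]
    refine Finset.sum_congr rfl fun c _ => Finset.sum_congr rfl fun u' hu' => ?_
    rw [step u' (Finset.mem_range.1 hu'), Finset.smul_sum]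
    refine Finset.sum_congr rfl fun q _ => ?_
    rw [smul_smul]
    congr 1
    ring
  have outer : ∀ q v', ∑ b : Bool, ∑ u ∈ Finset.range (j + 1),
      cgTransform j (fun u' c => symPower A j u u' * A b c) q v' •
        tensorLin (P.step (2 * t + j) b (Finsupp.single (regConf enc t u w) 1)) (S q v') =
      ∑ p : Bool, ∑ v ∈ Finset.range (j + 2 - 2 * p.toNat),
        cgTransform j (fun u b => cgTransform j (fun u' c => symPower A j u u' * A b c) q v') p v •
          tensorLin (S p v) (S q v') := by
    intro q v'
    rw [← sum_cgCoeff_smul j (fun u b => cgTransform j (fun u' c => symPower A j u u' * A b c) q v')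
      fun p v => tensorLin (S p v) (S q v')]
    refine Finset.sum_congr rfl fun b _ => Finset.sum_congr rfl fun u hu => ?_
    rw [step u (Finset.mem_range.1 hu), map_sum, LinearMap.sum_apply, Finset.smul_sum]
    refine Finset.sum_congr rfl fun p _ => ?_
    rw [map_smul, LinearMap.smul_apply, smul_smul]
    congr 1
    ring
  have lhs : ∑ b : Bool, ∑ c : Bool, A b c • localMap (P.step (2 * t + j) b)
      (P.step (2 * t + j) c) (blockState enc A (2 * t + j) t w) =
      detTwo A ^ t • ∑ b : Bool, ∑ u ∈ Finset.range (j + 1),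
        tensorLin (P.step (2 * t + j) b (Finsupp.single (regConf enc t u w) 1))
          (∑ c : Bool, ∑ u' ∈ Finset.range (j + 1), (A b c * symPower A j u u') •
            P.step (2 * t + j) c (Finsupp.single (regConf enc t u' w) 1)) := by
    rw [Finset.smul_sum]
    refine Finset.sum_congr rfl fun b _ => ?_
    simp only [blockState, blockCoeff, hj, hj1, map_sum, map_smul, localMap_single, Finset.smul_sum]
    rw [Finset.sum_comm]
    refine Finset.sum_congr rfl fun u _ => Finset.sum_congr rfl fun c _ =>
      Finset.sum_congr rfl fun u' _ => ?_
    rw [smul_smul, smul_smul]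
    congr 1
    ring
  rw [lhs]
  simp only [inner, map_sum, map_smul]
  have swap : ∑ b : Bool, ∑ u ∈ Finset.range (j + 1), ∑ q : Bool,
      ∑ v' ∈ Finset.range (j + 2 - 2 * q.toNat),
      cgTransform j (fun u' c => symPower A j u u' * A b c) q v' •
        tensorLin (P.step (2 * t + j) b (Finsupp.single (regConf enc t u w) 1)) (S q v') =
      ∑ q : Bool, ∑ v' ∈ Finset.range (j + 2 - 2 * q.toNat), ∑ b : Bool,
        ∑ u ∈ Finset.range (j + 1), cgTransform j (fun u' c => symPower A j u u' * A b c) q v' •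
        tensorLin (P.step (2 * t + j) b (Finsupp.single (regConf enc t u w) 1)) (S q v') := by
    calc _ = ∑ b : Bool, ∑ q : Bool, ∑ v' ∈ Finset.range (j + 2 - 2 * q.toNat),
          ∑ u ∈ Finset.range (j + 1), cgTransform j (fun u' c => symPower A j u u' * A b c) q v' •
          tensorLin (P.step (2 * t + j) b (Finsupp.single (regConf enc t u w) 1)) (S q v') := by
          refine Finset.sum_congr rfl fun b _ => ?_
          rw [Finset.sum_comm]
          exact Finset.sum_congr rfl fun q _ => Finset.sum_comm
      _ = _ := by
          rw [Finset.sum_comm]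
          exact Finset.sum_congr rfl fun q _ => Finset.sum_comm
  rw [swap]
  simp only [outer]
  rw [Finset.smul_sum]
  refine Finset.sum_congr rfl fun q _ => ?_
  have hq : q.toNat ≤ 1 := Bool.toNat_le q
  rw [blockState, show 2 * t + j + 1 + 1 - 2 * (t + q.toNat) = j + 2 - 2 * q.toNat by omega,
    Finset.smul_sum]
  conv_rhs => rw [Finset.sum_comm]
  refine Finset.sum_congr rfl fun v' hv' => ?_
  rw [Finset.sum_eq_single q, Finset.smul_sum]
  · refine Finset.sum_congr rfl fun v hv => ?_
    rw [cgTransform_symPower A (Finset.mem_range.1 hv) (Finset.mem_range.1 hv'), if_pos rfl,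
      smul_smul, hS, tensorLin_single, blockCoeff, ← mul_assoc, pow_add,
      show 2 * t + j + 1 - 2 * (t + q.toNat) = j + 1 - 2 * q.toNat by omega]
  · intro p _ hp
    refine Finset.sum_eq_zero fun v hv => ?_
    rw [cgTransform_symPower A (Finset.mem_range.1 hv) (Finset.mem_range.1 hv'), if_neg hp,
      zero_smul]
  · simp

/-- Schur–Weyl duality with multiplicities labelled by words: the coefficients depend on `t`, `u`,
`u'` but not on `w`, which is the maximal entanglement of the tapes. In the induction
`sum_words_youngDim_succ` regroups the branches by their target diagram. -/
theorem jointState_eq (h0 : enc (0, 0, 0) = 0) (hP : StepRule P enc) (ψ : TwoQubit) (N : ℕ) :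
    P.jointState ψ N = ∑ t ∈ Finset.range (N + 1), ∑ w ∈ words (youngDim N t),
      blockState enc (fun b c => ψ (b, c)) N t w := by
  induction N with
  | zero =>
    have hw : words 1 = {[]} := by
      refine (Finset.eq_of_subset_of_card_le ?_ ?_).symm
      · simpa using nil_mem_words_one
      · simp [card_words]
    simp [StreamingProtocol.jointState, StreamingProtocol.run, youngDim, hw, blockState,
      blockCoeff, symPower, symNorm, symCoeff, tensor_eq, tensorLin_single, regConf, h0,
      -Finsupp.single_mul]
  | succ N ih =>
    set A : Bool → Bool → ℂ := fun b c => ψ (b, c) with hA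
    set B := blockState enc A (N + 1) with hB
    have hBzero : ∀ t, N + 1 < 2 * t → ∀ w, B t w = 0 := by
      intro t ht w
      rw [hB, blockState, show N + 1 + 1 - 2 * t = 0 by omega]
      simp
    have h1 : P.jointState ψ (N + 1) = ∑ t ∈ Finset.range (N + 1), ∑ w ∈ words (youngDim N t),
        ∑ p : Bool, B (t + p.toNat) (eliasWord N (t + p.toNat) p w) := by
      rw [jointState_succ, ih]
      simp only [map_sum, Finset.smul_sum]
      calc _ = ∑ t ∈ Finset.range (N + 1), ∑ w ∈ words (youngDim N t), ∑ b : Bool, ∑ c : Bool,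
            A b c • localMap (P.step N b) (P.step N c) (blockState enc A N t w) := by
            rw [Finset.sum_congr rfl fun b _ => Finset.sum_comm, Finset.sum_comm]
            refine Finset.sum_congr rfl fun t _ => ?_
            rw [Finset.sum_congr rfl fun b _ => Finset.sum_comm, Finset.sum_comm]
        _ = _ := Finset.sum_congr rfl fun t _ => Finset.sum_congr rfl fun w hw =>
            localMap_blockState hP A hw
    have h2 : ∑ t ∈ Finset.range (N + 2), ∑ w ∈ words (youngDim (N + 1) t), B t w =
        ∑ t ∈ Finset.range (N + 2), (∑ w ∈ words (youngDim N t), B t (eliasWord N t false w) +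
          ∑ w ∈ words (youngDimPred N t), B t (eliasWord N t true w)) := by
      refine Finset.sum_congr rfl fun t _ => ?_
      by_cases ht : 2 * t ≤ N + 1
      · exact sum_words_youngDim_succ ht _
      · simp only [hBzero t (by omega), Finset.sum_const_zero, add_zero]
    -- The branches `p = true` shift `t` by one; the top term for `p = false` and the term `t = 0`
    -- for `p = true` are empty.
    rw [h1, h2, Finset.sum_add_distrib, Finset.sum_range_succ _ (N + 1),
      youngDim_eq_zero (show N < 2 * (N + 1) by omega),
      Finset.sum_range_succ' (fun t => ∑ w ∈ words (youngDimPred N t), _)]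
    simp only [youngDimPred, Fintype.sum_bool, Bool.toNat_true, Bool.toNat_false, add_zero,
      Finset.sum_add_distrib]
    simp [words, add_comm]

theorem blockState_apply (A : Bool → Bool → ℂ) (N t : ℕ)
    (w : List Bool) (x y : Conf) :
    blockState enc A N t w (x, y) =
      if w = x.out then
        (if x.cell = false ∧ y.cell = false ∧ x.out = y.out then
          ∑ u ∈ Finset.range (N + 1 - 2 * t), ∑ u' ∈ Finset.range (N + 1 - 2 * t),
            if x.mem = enc (t, u, x.out.length) ∧ y.mem = enc (t, u', x.out.length) then
              blockCoeff A N t u u' else 0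
          else 0)
      else 0 := by
  classical
  obtain ⟨m, c, o⟩ := x
  obtain ⟨m', c', o'⟩ := y
  simp only [blockState, Finsupp.finsetSum_apply, Finsupp.smul_apply, Finsupp.single_apply,
    smul_eq_mul, mul_ite, mul_one, mul_zero, Prod.mk.injEq, regConf, Conf.mk.injEq]
  split_ifs with h1 h2
  · obtain ⟨rfl, rfl, rfl⟩ := h2
    subst h1
    simp [eq_comm]
  · refine Finset.sum_eq_zero fun u _ => Finset.sum_eq_zero fun u' _ => if_neg ?_
    subst h1
    rintro ⟨⟨-, h3, -⟩, -, h4, h5⟩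
    exact h2 ⟨h3.symm, h4.symm, h5⟩
  · refine Finset.sum_eq_zero fun u _ => Finset.sum_eq_zero fun u' _ => if_neg ?_
    rintro ⟨⟨-, -, h3⟩, -⟩
    exact h1 h3

theorem holdsPerfectEPR_of_stepRule (h0 : enc (0, 0, 0) = 0)
    (hP : StepRule P enc) (ψ : TwoQubit) (N : ℕ) : HoldsPerfectEPR (P.jointState ψ N) := by
  -- The factor compensates the normalization of the `ℓ` EPR pairs, because the block coefficients
  -- are amplitudes of single words.
  refine ⟨fun ℓ m m' => (Real.sqrt 2 : ℂ) ^ ℓ * ∑ t ∈ Finset.range (N + 1),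
    if (youngDim N t).testBit ℓ = true then
      ∑ u ∈ Finset.range (N + 1 - 2 * t), ∑ u' ∈ Finset.range (N + 1 - 2 * t),
        if m = enc (t, u, ℓ) ∧ m' = enc (t, u', ℓ) then
          blockCoeff (fun b c => ψ (b, c)) N t u u' else 0
    else 0, fun x y => ?_⟩
  rw [jointState_eq h0 hP]
  simp only [Finsupp.finsetSum_apply, blockState_apply, Finset.sum_ite_eq', mem_words]
  split_ifs with h
  · have h2 : (Real.sqrt 2 : ℂ) ≠ 0 := by
      exact_mod_cast (Real.sqrt_pos.2 (by norm_num)).ne'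
    rw [mul_right_comm, ← mul_pow, mul_one_div_cancel h2, one_pow, one_mul]
  · simp

/-! ### The expected yield as a function of the spectrum -/

theorem expectedYield_sum_single {ι : Type*} (J : Finset ι) (pt : ι → Conf × Conf) (c : ι → ℂ)
    (hpt : Set.InjOn pt J) :
    expectedYield (∑ i ∈ J, c i • Finsupp.single (pt i) 1) =
      ∑ i ∈ J, ‖c i‖ ^ 2 * ((pt i).1.out.length : ℝ) := by
  classical
  have happ : ∀ i ∈ J, (∑ i ∈ J, c i • Finsupp.single (pt i) (1 : ℂ)) (pt i) = c i := by
    intro i hi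
    rw [Finsupp.finsetSum_apply, Finset.sum_eq_single i]
    · simp
    · intro k hk hne
      rw [Finsupp.smul_apply, Finsupp.single_eq_of_ne, smul_zero]
      exact fun h => hne (hpt hk hi h.symm)
    · exact fun h => absurd hi h
  rw [expectedYield, Finsupp.sum_of_support_subset (s := J.image pt), Finset.sum_image hpt]
  · exact Finset.sum_congr rfl fun i hi => by rw [happ i hi]
  · intro z hz
    by_contra hcon
    rw [Finsupp.mem_support_iff, Finsupp.finsetSum_apply] at hz
    refine hz (Finset.sum_eq_zero fun i hi => ?_)
    rw [Finsupp.smul_apply, Finsupp.single_eq_of_ne, smul_zero]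
    rintro rfl
    exact hcon (Finset.mem_image_of_mem _ hi)
  · simp

/-- Each word of diagram `t` has probability `(x * y) ^ t` times the squared norm of the symmetric
power, which is a complete homogeneous polynomial in `x` and `y`. -/
theorem expectedYield_eq (henc : Function.Injective enc) (h0 : enc (0, 0, 0) = 0)
    (hP : StepRule P enc) (ψ : TwoQubit) {x y : ℝ} (hs : ∑ b, ∑ c, ‖ψ (b, c)‖ ^ 2 = x + y)
    (hd : ‖detTwo fun b c => ψ (b, c)‖ ^ 2 = x * y) (N : ℕ) :
    expectedYield (P.jointState ψ N) = spectralYield x y N := by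
  set A : Bool → Bool → ℂ := fun b c => ψ (b, c) with hA
  have h1 : P.jointState ψ N = ∑ i ∈ (Finset.range (N + 1)).sigma fun t =>
      words (youngDim N t) ×ˢ Finset.range (N + 1 - 2 * t) ×ˢ Finset.range (N + 1 - 2 * t),
      blockCoeff A N i.1 i.2.2.1 i.2.2.2 •
        Finsupp.single (regConf enc i.1 i.2.2.1 i.2.1, regConf enc i.1 i.2.2.2 i.2.1) 1 := by
    rw [jointState_eq h0 hP, Finset.sum_sigma]
    simp only [Finset.sum_product, blockState]
    rfl
  rw [h1, expectedYield_sum_single]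
  · rw [Finset.sum_sigma, spectralYield]
    refine Finset.sum_congr rfl fun t _ => ?_
    simp only [Finset.sum_product, regConf]
    rw [wordsLength, Finset.sum_mul]
    refine Finset.sum_congr rfl fun w hw => ?_
    have ht : 2 * t ≤ N := by
      by_contra h
      rw [youngDim_eq_zero (by omega), mem_words] at hw
      simp at hw
    simp only [← Finset.sum_mul]
    rw [mul_comm]
    congr 1
    simp only [blockCoeff, norm_mul, mul_pow, ← Finset.mul_sum]
    have h2 := symPowerNormSq_eq A hs hd (N - 2 * t)
    rw [symPowerNormSq, show N - 2 * t + 1 = N + 1 - 2 * t by omega] at h2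
    rw [h2, norm_pow, ← pow_mul, mul_comm t 2, pow_mul, hd, Finset.mul_sum]
    refine Finset.sum_congr rfl fun u hu => ?_
    rw [Finset.mem_range] at hu
    rw [mul_pow, show N - (t + u) = t + (N - 2 * t - u) by omega, pow_add, pow_add]
    ring
  · rintro ⟨t, w, u, u'⟩ - ⟨t2, w2, u2, u2'⟩ - h
    simp only [Prod.mk.injEq, regConf_inj henc] at h
    obtain ⟨⟨rfl, rfl, rfl⟩, -, rfl, -⟩ := h
    rfl

end

/-! ### The spectrum of the reduced state -/

-- Here `x` and `y` are the eigenvalues; the relations are the trace and the determinant of the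
-- reduced state.
open scoped ComplexOrder in
theorem exists_spectrum (ψ : TwoQubit) (hψ : ‖ψ‖ = 1) :
    ∃ x y : ℝ, 0 ≤ x ∧ 0 ≤ y ∧ x + y = 1 ∧ ∑ b, ∑ c, ‖ψ (b, c)‖ ^ 2 = x + y ∧
      ‖detTwo fun b c => ψ (b, c)‖ ^ 2 = x * y ∧ entanglement ψ = binaryEntropy x y := by
  have hH := reducedState_isHermitian ψ
  have hpos : (reducedState ψ).PosSemidef := Matrix.posSemidef_self_mul_conjTranspose _
  have hnorm : ∑ b, ∑ c, ‖ψ (b, c)‖ ^ 2 = 1 := by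
    have h := EuclideanSpace.norm_sq_eq ψ
    rw [hψ, Fintype.sum_prod_type] at h
    rw [← h]; norm_num
  have htr : hH.eigenvalues true + hH.eigenvalues false = 1 := by
    have h := hH.trace_eq_sum_eigenvalues
    rw [Fintype.sum_bool] at h
    have h2 : (reducedState ψ).trace = ((∑ b, ∑ c, ‖ψ (b, c)‖ ^ 2 : ℝ) : ℂ) := by
      simp only [Matrix.trace, Matrix.diag, reducedState, Matrix.mul_apply,
        Matrix.conjTranspose_apply, coeffMatrix, Matrix.of_apply, Complex.ofReal_sum,
        Complex.ofReal_pow, RCLike.star_def, Complex.mul_conj']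
    rw [h2, hnorm] at h
    exact (Complex.ofReal_injective (h.trans (Complex.ofReal_add _ _).symm)).symm
  have hdet : ‖detTwo fun b c => ψ (b, c)‖ ^ 2 = hH.eigenvalues true * hH.eigenvalues false := by
    have h := hH.det_eq_prod_eigenvalues
    rw [Fintype.prod_bool] at h
    have h2 : (reducedState ψ).det = ((‖detTwo fun b c => ψ (b, c)‖ ^ 2 : ℝ) : ℂ) := by
      have h3 : (coeffMatrix ψ).det = detTwo fun b c => ψ (b, c) := by
        rw [← Matrix.det_reindex_self (finTwoEquiv.symm), Matrix.det_fin_two]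
        simp [coeffMatrix, detTwo, finTwoEquiv]
      rw [reducedState, Matrix.det_mul, Matrix.det_conjTranspose, h3, RCLike.star_def,
        Complex.mul_conj']
      push_cast; rfl
    rw [h2] at h
    exact Complex.ofReal_injective (h.trans (Complex.ofReal_mul _ _).symm)
  refine ⟨_, _, hpos.eigenvalues_nonneg true, hpos.eigenvalues_nonneg false, htr,
    hnorm.trans htr.symm, hdet, ?_⟩
  rw [entanglement, binaryEntropy, Fintype.sum_bool]

/-- The claims about reversibility, the output state and the yield hold for every protocol that
interleaves the Clebsch–Gordan transform with the streaming Elias transform. -/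
theorem StreamingProtocol.InterleavesSchurElias.performance {P : StreamingProtocol}
    (h : P.InterleavesSchurElias) :
    P.IsReversible ∧ ∃ C : ℝ, ∀ ψ : TwoQubit, ‖ψ‖ = 1 →
      (∀ N : ℕ,
        HoldsPerfectEPR (P.jointState ψ N) ∧
        N * entanglement ψ - C * Real.log (N + 1) ≤ expectedYield (P.jointState ψ N) ∧
        expectedYield (P.jointState ψ N) ≤ N * entanglement ψ) ∧
      ∃ K : ℝ, ∀ N : ℕ, ∃ k : ℕ,
        (k : ℝ) ≤ K * Real.log (N + 1) ∧
        N * entanglement ψ ≤ expectedYield (P.jointState ψ (N + k)) := by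
  obtain ⟨enc, henc, h0, hP⟩ := h.exists_stepRule
  have hlog : 0 < Real.log 2 := Real.log_pos (by norm_num)
  refine ⟨isReversible_of_stepRule henc h0 hP, 5 / Real.log 2, fun ψ hψ => ?_⟩
  obtain ⟨x, y, hx, hy, hxy, hs, hd, hE⟩ := exists_spectrum ψ hψ
  have hY := expectedYield_eq henc h0 hP ψ hs hd
  have lower := le_spectralYield hx hy hxy
  have upper := spectralYield_le hx hy hxy
  simp only [hY, hE]
  refine ⟨fun N => ⟨holdsPerfectEPR_of_stepRule h0 hP ψ N, lower N, upper N⟩, ?_⟩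
  refine exists_lag ?_ (by positivity) (fun N => spectralYield_nonneg hx hy N) lower
  have := (spectralYield_nonneg hx hy 1).trans (upper 1)
  simpa using this

/-! ### Synthesis of gates -/

/-- Every isometric prescription on some basis states is realised by a unitary gate. -/
theorem exists_gate {q : ℕ} {α κ : Type} [DecidableEq α] [Fintype κ] (src : α → ℕ × Bool)
    (hsrc : Function.Injective src) (hsrcb : ∀ a, (src a).1 < 2 ^ q) (tgt : α → κ → ℕ × Bool)
    (htgtb : ∀ a k, (tgt a k).1 < 2 ^ q) (c : α → κ → ℝ)
    (horth : ∀ a a', ∑ k, ∑ k', (if tgt a k = tgt a' k' then c a k * c a' k' else 0) =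
      if a = a' then 1 else 0) :
    ∃ U : Matrix.unitaryGroup (Fin (2 ^ q) × Bool) ℂ, ∀ a w,
      (Instr.gate U).act (Finsupp.single ⟨(src a).1, (src a).2, w⟩ 1) =
        ∑ k, (c a k : ℂ) • Finsupp.single ⟨(tgt a k).1, (tgt a k).2, w⟩ 1 := by
  classical
  set S : α → Fin (2 ^ q) × Bool := fun a => (⟨(src a).1, hsrcb a⟩, (src a).2) with hS
  set T : α → κ → Fin (2 ^ q) × Bool := fun a k => (⟨(tgt a k).1, htgtb a k⟩, (tgt a k).2) with hT
  have hSinj : Function.Injective S := by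
    intro a a' h
    simp only [hS, Prod.mk.injEq, Fin.mk.injEq] at h
    exact hsrc (Prod.ext h.1 h.2)
  have hTiff : ∀ a k a' k', T a k = T a' k' ↔ tgt a k = tgt a' k' := by
    intro a k a' k'
    simp only [hT, Fin.mk.injEq, Prod.ext_iff]
  set vec : α → EuclideanSpace ℂ (Fin (2 ^ q) × Bool) :=
    fun a => ∑ k, (c a k : ℂ) • EuclideanSpace.single (T a k) (1 : ℂ) with hvec
  have hinner : ∀ a a', inner ℂ (vec a) (vec a') = if a = a' then (1 : ℂ) else 0 := by
    intro a a'
    have h := congrArg Complex.ofReal (horth a a')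
    have h2 : inner ℂ (vec a) (vec a') =
        ((∑ k, ∑ k', (if tgt a k = tgt a' k' then c a k * c a' k' else 0) : ℝ) : ℂ) := by
      simp only [hvec, sum_inner, inner_sum, inner_smul_left, inner_smul_right,
        Complex.conj_ofReal, EuclideanSpace.inner_single_left, map_one, one_mul,
        PiLp.single_apply, hTiff, Complex.ofReal_sum]
      rw [Finset.sum_comm]
      simp only [Finset.mul_sum]
      refine Finset.sum_congr rfl fun k _ => Finset.sum_congr rfl fun k' _ => ?_
      split_ifs <;> simp [mul_comm]
    rw [h2, h]
    split_ifs <;> simp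
  -- The prescribed images, indexed by their sources, are completed to an orthonormal basis of the
  -- whole gate space; its coordinate matrix is the unitary.
  obtain ⟨b, hb⟩ := Orthonormal.exists_orthonormalBasis_extension_of_card_eq (𝕜 := ℂ)
    (E := EuclideanSpace ℂ (Fin (2 ^ q) × Bool)) (ι := Fin (2 ^ q) × Bool) (by simp)
    (v := Function.extend S vec 0) (s := Set.range S) (by
      rw [orthonormal_iff_ite]
      rintro ⟨_, a, rfl⟩ ⟨_, a', rfl⟩
      simp only [Set.domRestrict_apply, hSinj.extend_apply, hinner]
      exact if_congr ⟨fun h => by subst h; rfl, fun h => hSinj (congrArg Subtype.val h)⟩ rfl rfl)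
  refine ⟨⟨(EuclideanSpace.basisFun _ ℂ).toBasis.toMatrix b,
    OrthonormalBasis.toMatrix_orthonormalBasis_mem_unitary _ _⟩, fun a w => ?_⟩
  have hcol : ∀ y, (EuclideanSpace.basisFun (Fin (2 ^ q) × Bool) ℂ).toBasis.toMatrix b y (S a) =
      ∑ k, if y = T a k then (c a k : ℂ) else 0 := by
    intro y
    rw [Module.Basis.toMatrix_apply, hb _ ⟨a, rfl⟩, hSinj.extend_apply]
    simp [hvec, Finset.sum_apply, PiLp.single_apply]
  rw [Instr.act, Finsupp.linearCombination_single, one_smul, Instr.onBasis]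
  simp only
  rw [dif_pos (hsrcb a)]
  have : ∀ y : Fin (2 ^ q) × Bool, (Finsupp.single (⟨y.1, y.2, w⟩ : Conf)
      ((EuclideanSpace.basisFun (Fin (2 ^ q) × Bool) ℂ).toBasis.toMatrix b y
        (⟨(src a).1, hsrcb a⟩, (src a).2))) =
      ∑ k, if y = T a k then Finsupp.single (⟨y.1, y.2, w⟩ : Conf) (c a k : ℂ) else 0 := by
    intro y
    rw [show ((⟨(src a).1, hsrcb a⟩, (src a).2) : Fin (2 ^ q) × Bool) = S a from rfl, hcol,
      ← Finsupp.singleAddHom_apply, map_sum]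
    refine Finset.sum_congr rfl fun k _ => ?_
    split_ifs <;> simp
  rw [Finset.sum_congr rfl fun y _ => this y, Finset.sum_comm]
  refine Finset.sum_congr rfl fun k _ => ?_
  rw [Finset.sum_ite_eq' Finset.univ (T a k), if_pos (Finset.mem_univ _), Finsupp.smul_single,
    smul_eq_mul, mul_one]

/-- Every injective prescription on some basis states is realised by a unitary gate. -/
theorem exists_basisGate {q : ℕ} {α : Type} (src tgt : α → ℕ × Bool)
    (hsrc : Function.Injective src) (htgt : Function.Injective tgt)
    (hsrcb : ∀ a, (src a).1 < 2 ^ q) (htgtb : ∀ a, (tgt a).1 < 2 ^ q) :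
    ∃ U : Matrix.unitaryGroup (Fin (2 ^ q) × Bool) ℂ, ∀ a w,
      (Instr.gate U).act (Finsupp.single ⟨(src a).1, (src a).2, w⟩ 1) =
        Finsupp.single ⟨(tgt a).1, (tgt a).2, w⟩ 1 := by
  classical
  obtain ⟨U, hU⟩ := exists_gate (κ := Unit) src hsrc hsrcb (fun a _ => tgt a)
    (fun a _ => htgtb a) (fun _ _ => 1) (by simp [htgt.eq_iff])
  exact ⟨U, fun a w => by simpa using hU a w⟩

/-! ### Labels of the memory -/

/-- The label of the memory for the registers `t`, `u`, `l` and the control register `g`, which is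
`0` between two inputs, `1 + p` when the qubit `p` waits for the streaming Elias transform, and `3`
in its carry loop. -/
def label (g t u l : ℕ) : ℕ := Nat.pair (Nat.pair t u) (Nat.pair l g)

theorem label_inj {g t u l g' t' u' l' : ℕ} :
    label g t u l = label g' t' u' l' ↔ g = g' ∧ t = t' ∧ u = u' ∧ l = l' := by
  simp only [label, Nat.pair_eq_pair]
  tauto

/-- The number of memory qubits. -/
def schurEliasQubits (n : ℕ) : ℕ := 4 * (Nat.log 2 (n + 4) + 1)

theorem label_lt {n g t u l : ℕ} (hg : g ≤ 3) (ht : t ≤ n + 1) (hu : u ≤ n + 1) (hl : l ≤ n + 2) :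
    label g t u l < 2 ^ schurEliasQubits n := by
  have h1 : Nat.pair t u < (n + 4) ^ 2 :=
    (Nat.pair_lt_max_add_one_sq t u).trans_le (Nat.pow_le_pow_left (by omega) 2)
  have h2 : Nat.pair l g < (n + 4) ^ 2 :=
    (Nat.pair_lt_max_add_one_sq l g).trans_le (Nat.pow_le_pow_left (by omega) 2)
  have h3 : label g t u l < ((n + 4) ^ 2) ^ 2 :=
    (Nat.pair_lt_max_add_one_sq _ _).trans_le (Nat.pow_le_pow_left (by omega) 2)
  have h4 : n + 4 < 2 ^ (Nat.log 2 (n + 4) + 1) := Nat.lt_pow_succ_log_self (by norm_num) _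
  calc _ < (n + 4) ^ 4 := by rw [← pow_mul] at h3; exact h3
    _ ≤ (2 ^ (Nat.log 2 (n + 4) + 1)) ^ 4 := Nat.pow_le_pow_left h4.le 4
    _ = _ := by rw [← pow_mul, schurEliasQubits, mul_comm]

theorem schurEliasQubits_isBigO :
    (fun N : ℕ => ((schurEliasQubits N + 1 : ℕ) : ℝ)) =O[atTop] fun N : ℕ => Real.log N := by
  have hlog : 0 < Real.log 2 := Real.log_pos (by norm_num)
  -- For `N ≥ 2` one has `N + 4 ≤ N ^ 3`, so there are at most `4 * (3 * log₂ N + 1) + 1 ≤ 17 * log₂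
  -- N` qubits.
  refine IsBigO.of_bound (17 / Real.log 2) ?_
  filter_upwards [eventually_ge_atTop 2] with N hN
  have hN' : (2 : ℝ) ≤ N := by exact_mod_cast hN
  have h1 : Real.log 2 ≤ Real.log N := Real.log_le_log (by norm_num) hN'
  have h2 : (Nat.log 2 (N + 4) : ℝ) * Real.log 2 ≤ 3 * Real.log N := by
    have h3 : 2 ^ Nat.log 2 (N + 4) ≤ N + 4 := Nat.pow_log_le_self 2 (by omega)
    have h4 : N + 4 ≤ N ^ 3 := by nlinarith [Nat.mul_le_mul hN hN]
    rw [← Real.log_pow, show (3 : ℝ) * Real.log N = Real.log ((N : ℝ) ^ 3) by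
      rw [Real.log_pow]; norm_num]
    exact Real.log_le_log (by positivity) (by exact_mod_cast h3.trans h4)
  rw [Real.norm_of_nonneg (Nat.cast_nonneg _), Real.norm_of_nonneg (by linarith),
    div_mul_eq_mul_div, le_div_iff₀ hlog, schurEliasQubits]
  push_cast
  linarith

/-! ### The gates of the protocol -/

/-- The control register keeps `p` and `l` is untouched, so outputs from different pairs `(t, l)`
never overlap; for equal pairs orthonormality is `cgCoeff_orthonormal`. -/
theorem exists_cgGate (n : ℕ) :
    ∃ U : Matrix.unitaryGroup (Fin (2 ^ schurEliasQubits n) × Bool) ℂ, ∀ t u l b w,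
      2 * t ≤ n → u ≤ n - 2 * t → l ≤ n →
      (Instr.gate U).act (Finsupp.single ⟨label 0 t u l, b, w⟩ 1) =
        ∑ p : Bool, (cgCoeff (n - 2 * t) u b p : ℂ) •
          Finsupp.single ⟨label (1 + p.toNat) (t + p.toNat) (cgTarget u b p) l, false, w⟩ 1 := by
  obtain ⟨U, hU⟩ := exists_gate (q := schurEliasQubits n)
    (α := {x : ℕ × ℕ × ℕ × Bool // 2 * x.1 ≤ n ∧ x.2.1 ≤ n - 2 * x.1 ∧ x.2.2.1 ≤ n})
    (κ := Bool)
    (fun x => (label 0 x.1.1 x.1.2.1 x.1.2.2.1, x.1.2.2.2))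
    (by
      rintro ⟨⟨t, u, l, b⟩, _⟩ ⟨⟨t', u', l', b'⟩, _⟩ h
      simp only [Prod.mk.injEq, label_inj] at h
      simp [h])
    (by
      rintro ⟨⟨t, u, l, b⟩, h⟩
      simp only at h ⊢
      exact label_lt (by omega) (by omega) (by omega) (by omega))
    (fun x p => (label (1 + p.toNat) (x.1.1 + p.toNat) (cgTarget x.1.2.1 x.1.2.2.2 p) x.1.2.2.1,
      false))
    (by
      rintro ⟨⟨t, u, l, b⟩, h⟩ p
      simp only at h ⊢
      have := Bool.toNat_le p
      have := Bool.toNat_le b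
      exact label_lt (by omega) (by omega) (by simp only [cgTarget]; omega) (by omega))
    (fun x p => cgCoeff (n - 2 * x.1.1) x.1.2.1 x.1.2.2.2 p)
    (by
      rintro ⟨⟨t, u, l, b⟩, h⟩ ⟨⟨t', u', l', b'⟩, h'⟩
      simp only at h h'
      simp only [Prod.mk.injEq, label_inj, and_true, Subtype.mk.injEq]
      by_cases hc : t = t' ∧ l = l'
      · obtain ⟨rfl, rfl⟩ := hc
        have := cgCoeff_orthonormal h.2.1 h'.2.1 b b'
        simp only [true_and, and_true]
        rw [← this]
        refine Finset.sum_congr rfl fun p _ => ?_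
        rw [Finset.sum_eq_single p]
        · simp
        · intro p' _ hne
          rw [if_neg]
          rintro ⟨h1, -⟩
          exact hne (by cases p <;> cases p' <;> simp_all)
        · simp
      · rw [if_neg (fun h => hc ⟨h.1, h.2.2.1⟩)]
        refine Finset.sum_eq_zero fun p _ => Finset.sum_eq_zero fun p' _ => if_neg ?_
        rintro ⟨h1, h2, -, h3⟩
        exact hc ⟨by omega, h3⟩)
  exact ⟨U, fun t u l b w h1 h2 h3 => hU ⟨(t, u, l, b), h1, h2, h3⟩ w⟩

/-- Whether the predecessor from which the streaming Elias transform arrives at `(n + 1, t)` has a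
block of `2 ^ l` paths. -/
def SourceBit (n t l : ℕ) (p : Bool) : Prop :=
  (if p then youngDimPred n t else youngDim n t).testBit l = true

/-- Whether the streaming Elias transform emits `p` at position `l`. -/
abbrev Emits (n t l : ℕ) (p : Bool) : Prop :=
  (youngDim (n + 1) t).testBit l = false ∨
    (if p then youngDim n t else youngDimPred n t).testBit l = true

/-- The basis states on which the gate for position `L` acts. -/
inductive StageInput (n L : ℕ) : Type where
  | done (t u l : ℕ) (ht : t ≤ n + 1) (hu : u ≤ n + 1) (hl : l < L) : StageInput n L
  | wait (p : Bool) (t u l : ℕ) (ht : t ≤ n + 1) (hu : u ≤ n + 1) (hl : L < l) (hn : l ≤ n) :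
    StageInput n L
  | start (p : Bool) (t u : ℕ) (ht : t ≤ n + 1) (hu : u ≤ n + 1) (h : SourceBit n t L p) :
    StageInput n L
  | carry (t u : ℕ) (ht : t ≤ n + 1) (hu : u ≤ n + 1) : StageInput n L

/-- The label and the cell before the gate for position `L`. -/
def StageInput.src {n L : ℕ} : StageInput n L → ℕ × Bool
  | .done t u l _ _ _ => (label 0 t u l, false)
  | .wait p t u l _ _ _ _ => (label (1 + p.toNat) t u l, false)
  | .start p t u _ _ _ => (label (1 + p.toNat) t u L, false)
  | .carry t u _ _ => (label 3 t u L, false)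

/-- The label and the cell after the gate for position `L`. -/
def StageInput.tgt {n L : ℕ} : StageInput n L → ℕ × Bool
  | .done t u l _ _ _ => (label 0 t u l, false)
  | .wait p t u l _ _ _ _ => (label (1 + p.toNat) t u l, false)
  | .start p t u _ _ _ => if Emits n t L p then (label 3 t u (L + 1), p) else (label 0 t u L, false)
  | .carry t u _ _ =>
      if (youngDim n t).testBit L ≠ (youngDimPred n t).testBit L then
        (label 3 t u (L + 1), (youngDim n t).testBit L)
      else (label 0 t u L, false)

theorem toNat_inj {p q : Bool} : p.toNat = q.toNat ↔ p = q := by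
  cases p <;> cases q <;> simp

theorem one_add_toNat_ne_three (p : Bool) : 1 + p.toNat ≠ 3 := by cases p <;> simp

theorem StageInput.src_injective (n L : ℕ) :
    Function.Injective (StageInput.src (n := n) (L := L)) := by
  intro x y h
  cases x <;> cases y <;>
    simp only [StageInput.src, Prod.mk.injEq, label_inj, and_true, true_and, Nat.add_left_cancel_iff,
      toNat_inj] at h <;>
    first
    | (exfalso; omega)
    | (exfalso; exact one_add_toNat_ne_three _ h.1)
    | (exfalso; exact one_add_toNat_ne_three _ h.1.symm)
    | simp [h]

/-- A word that stays at position `L` does so at unequal bits, whereas the carry loop ends at equal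
bits; the two cannot collide. The bits also determine `p`. -/
theorem SourceBit.testBit_of_not_emits {n t L : ℕ} {p : Bool} (h : SourceBit n t L p)
    (he : ¬ Emits n t L p) :
    (youngDimPred n t).testBit L = p ∧ (youngDim n t).testBit L = !p := by
  rw [SourceBit] at h
  cases p <;> simp_all

/-- A new carry writes `p` into the cell and a continuing carry writes the bit of `(n, t)`; this
keeps the two apart. -/
theorem SourceBit.testBit_ne {n t L : ℕ} {p : Bool} (h : SourceBit n t L p)
    (hne : (youngDim n t).testBit L ≠ (youngDimPred n t).testBit L) :
    (youngDim n t).testBit L ≠ p := by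
  rw [SourceBit] at h
  cases p <;> simp_all

/-- This is the local form of `addWord_injective`: only cases that finish at `L`, or that enter the
loop at `L + 1`, could collide, and the two preceding lemmas separate them. -/
theorem StageInput.tgt_injective (n L : ℕ) :
    Function.Injective (StageInput.tgt (n := n) (L := L)) := by
  intro x y h
  cases x <;> cases y <;> simp only [StageInput.tgt] at h <;> (try split_ifs at h) <;>
    simp only [Prod.mk.injEq, label_inj, and_true, true_and, Nat.add_left_cancel_iff,
      toNat_inj, false_and, OfNat.ofNat_ne_zero,
      OfNat.zero_ne_ofNat] at h <;>
    first
    | (exfalso; omega)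
    | (exfalso; exact one_add_toNat_ne_three _ h.1.1)
    | (exfalso; exact one_add_toNat_ne_three _ h.1.1.symm)
    | simp [h]
  · rename_i p t u _ _ hp q t' u' _ _ hq hpe hqe
    obtain ⟨rfl, rfl⟩ := h
    have := (hp.testBit_of_not_emits hpe).1.symm.trans (hq.testBit_of_not_emits hqe).1
    simp [this]
  · rename_i p t u _ _ hp t' u' _ _ hpe hne
    obtain ⟨⟨rfl, rfl⟩, h⟩ := h
    exact absurd h.symm (hp.testBit_ne hne)
  · rename_i p t u _ _ hp t' u' _ _ hpe hne
    obtain ⟨rfl, rfl⟩ := h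
    obtain ⟨h1, h2⟩ := hp.testBit_of_not_emits hpe
    rw [h1, h2] at hne
    simp at hne
  · rename_i t u _ _ p t' u' _ _ hp hne hpe
    obtain ⟨⟨rfl, rfl⟩, h⟩ := h
    exact absurd h (hp.testBit_ne hne)
  · rename_i t u _ _ p t' u' _ _ hp hne hpe
    obtain ⟨rfl, rfl⟩ := h
    obtain ⟨h1, h2⟩ := hp.testBit_of_not_emits hpe
    rw [h1, h2] at hne
    simp at hne

theorem exists_stageGate (n L : ℕ) (hL : L ≤ n + 1) :
    ∃ U : Matrix.unitaryGroup (Fin (2 ^ schurEliasQubits n) × Bool) ℂ,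
      ∀ (x : StageInput n L) (w : List Bool),
        (Instr.gate U).act (Finsupp.single ⟨x.src.1, x.src.2, w⟩ 1) =
          Finsupp.single ⟨x.tgt.1, x.tgt.2, w⟩ 1 := by
  refine exists_basisGate _ _ (StageInput.src_injective n L) (StageInput.tgt_injective n L) ?_ ?_
  · intro x
    cases x <;> rename_i p <;>
      refine label_lt ?_ (by assumption) (by assumption) (by omega) <;>
      first | omega | (have := Bool.toNat_le ‹Bool›; omega)
  · intro x
    cases x <;> simp only [StageInput.tgt] <;> (try split_ifs) <;>
      refine label_lt ?_ (by assumption) (by assumption) (by omega) <;>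
      first | omega | (have := Bool.toNat_le ‹Bool›; omega)

/-! ### The protocol -/

/-- The emission that is controlled by the label of the carry loop. -/
def carryEmission (n : ℕ) : Instr (schurEliasQubits n) :=
  .emit fun m => decide ((Nat.unpair (Nat.unpair m).2).2 = 3)

theorem carryEmission_act_of_ne {n g t u l : ℕ} (hg : g ≠ 3) (c : Bool) (w : List Bool) :
    (carryEmission n).act (Finsupp.single ⟨label g t u l, c, w⟩ 1) =
      Finsupp.single ⟨label g t u l, c, w⟩ 1 := by
  rw [Instr.act, Finsupp.linearCombination_single, one_smul, carryEmission, Instr.onBasis]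
  simp [label, hg]

theorem carryEmission_act {n t u l : ℕ} (h : label 3 t u l < 2 ^ schurEliasQubits n) (c : Bool)
    (w : List Bool) :
    (carryEmission n).act (Finsupp.single ⟨label 3 t u l, c, w⟩ 1) =
      Finsupp.single ⟨label 3 t u l, false, w ++ [c]⟩ 1 := by
  rw [Instr.act, Finsupp.linearCombination_single, one_smul, carryEmission, Instr.onBasis]
  simp only
  rw [dif_pos h, if_pos (by simp [label])]

/-- The gate for position `L` of the streaming Elias transform. -/
noncomputable def stageGate (n L : ℕ) : Instr (schurEliasQubits n) :=
  if hL : L ≤ n + 1 then .gate (exists_stageGate n L hL).choose else .emit fun _ => false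

theorem stageGate_act {n L : ℕ} (hL : L ≤ n + 1) (x : StageInput n L) (w : List Bool) :
    (stageGate n L).act (Finsupp.single ⟨x.src.1, x.src.2, w⟩ 1) =
      Finsupp.single ⟨x.tgt.1, x.tgt.2, w⟩ 1 := by
  rw [stageGate, dif_pos hL]
  exact (exists_stageGate n L hL).choose_spec x w

/-- The protocol that interleaves the Clebsch–Gordan transform with the streaming Elias
transform. -/
noncomputable def schurEliasProtocol : StreamingProtocol where
  qubits := schurEliasQubits
  mono := fun m n h => by
    have : Nat.log 2 (m + 4) ≤ Nat.log 2 (n + 4) := Nat.log_mono_right (by omega)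
    simp only [schurEliasQubits]
    omega
  -- The data-dependent loop becomes a fixed sweep over the positions `0, …, n + 1`: a branch waits
  -- until its own `l` comes up, runs its carry, and then idles.
  program := fun n => .gate (exists_cgGate n).choose ::
    (List.range (n + 2)).flatMap fun L => [stageGate n L, carryEmission n]

/-- The action of the `k` stages from position `L` on. -/
noncomputable def stages (n : ℕ) : ℕ → ℕ → State →ₗ[ℂ] State
  | 0, _ => LinearMap.id
  | k + 1, L => stages n k (L + 1) ∘ₗ (carryEmission n).act ∘ₗ (stageGate n L).act

theorem foldl_stages (n k L : ℕ) (f : State →ₗ[ℂ] State) :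
    ((List.range' L k).flatMap fun L => [stageGate n L, carryEmission n]).foldl
      (fun f i => i.act ∘ₗ f) f = stages n k L ∘ₗ f := by
  induction k generalizing L f with
  | zero => rfl
  | succ k ih =>
    rw [List.range'_succ, List.flatMap_cons, List.foldl_append, ih]
    rfl

theorem schurEliasProtocol_step (n : ℕ) (b : Bool) :
    schurEliasProtocol.step n b =
      stages n (n + 2) 0 ∘ₗ (Instr.gate (exists_cgGate n).choose).act ∘ₗ read b := by
  rw [StreamingProtocol.step]
  simp only [schurEliasProtocol, List.foldl_cons, List.range_eq_range']
  exact foldl_stages n (n + 2) 0 _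

theorem stages_done {n t u l : ℕ} (ht : t ≤ n + 1) (hu : u ≤ n + 1) (w : List Bool) (k L : ℕ)
    (hl : l < L) (hL : L + k ≤ n + 2) :
    stages n k L (Finsupp.single ⟨label 0 t u l, false, w⟩ 1) =
      Finsupp.single ⟨label 0 t u l, false, w⟩ 1 := by
  induction k generalizing L with
  | zero => rfl
  | succ k ih =>
    have h := stageGate_act (show L ≤ n + 1 by omega) (.done t u l ht hu hl) w
    simp only [StageInput.src, StageInput.tgt] at h
    rw [stages, LinearMap.comp_apply, LinearMap.comp_apply, h,
      carryEmission_act_of_ne (by norm_num), ih (L + 1) (by omega) (by omega)]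

/-- Both dimensions are below `2 ^ (n + 1)`, so their bits agree at position `n + 1` and the last
stage always ends the loop. -/
theorem stages_carry {n t u : ℕ} (ht : t ≤ n + 1) (hu : u ≤ n + 1) (k L fuel : ℕ)
    (hL : L + k = n + 2) (hk : 1 ≤ k) (hf : k ≤ fuel) (w : List Bool) :
    stages n k L (Finsupp.single ⟨label 3 t u L, false, w⟩ 1) =
      Finsupp.single ⟨label 0 t u (eliasCarry n t fuel L).1, false,
        w ++ (eliasCarry n t fuel L).2⟩ 1 := by
  induction k generalizing L fuel w with
  | zero => omega
  | succ k ih =>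
    obtain ⟨fuel, rfl⟩ : ∃ m, fuel = m + 1 := ⟨fuel - 1, by omega⟩
    have h := stageGate_act (show L ≤ n + 1 by omega) (.carry t u ht hu) w
    simp only [StageInput.src, StageInput.tgt] at h
    rw [stages, LinearMap.comp_apply, LinearMap.comp_apply, h, eliasCarry]
    by_cases hne : (youngDim n t).testBit L ≠ (youngDimPred n t).testBit L
    · have hLn : L < n + 1 := by
        by_contra hcon
        have hle : 2 ^ (n + 1) ≤ 2 ^ L := Nat.pow_le_pow_right (by norm_num) (by omega)
        rw [Nat.testBit_lt_two_pow ((youngDim_lt n t).trans_le hle),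
          Nat.testBit_lt_two_pow ((youngDimPred_lt n t).trans_le hle)] at hne
        exact hne rfl
      rw [if_pos hne, if_pos hne,
        carryEmission_act (label_lt (by omega) ht hu (by omega)),
        ih (L + 1) fuel (by omega) (by omega) (by omega), List.append_assoc]
      rfl
    · rw [if_neg hne, if_neg hne, carryEmission_act_of_ne (by norm_num),
        stages_done ht hu w k (L + 1) (by omega) (by omega), List.append_nil]

/-- Stages before position `l` do nothing; stage `l` performs the test and hands over to
`stages_carry` or `stages_done`. -/
theorem stages_init {n t u l : ℕ} {p : Bool} (ht : t ≤ n + 1) (hu : u ≤ n + 1) (hl : l ≤ n)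
    (hp : SourceBit n t l p) (w : List Bool) (k L : ℕ) (hL : L + k = n + 2) (hLl : L ≤ l) :
    stages n k L (Finsupp.single ⟨label (1 + p.toNat) t u l, false, w⟩ 1) =
      Finsupp.single ⟨label 0 t u (eliasStep n t l p).1, false, w ++ (eliasStep n t l p).2⟩ 1 := by
  induction k generalizing L with
  | zero => omega
  | succ k ih =>
    rw [stages, LinearMap.comp_apply, LinearMap.comp_apply]
    rcases hLl.lt_or_eq with hlt | rfl
    · have h := stageGate_act (show L ≤ n + 1 by omega) (.wait p t u l ht hu hlt hl) w
      simp only [StageInput.src, StageInput.tgt] at h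
      rw [h, carryEmission_act_of_ne (one_add_toNat_ne_three p), ih (L + 1) (by omega) (by omega)]
    · have h := stageGate_act (show L ≤ n + 1 by omega) (.start p t u ht hu hp) w
      simp only [StageInput.src, StageInput.tgt] at h
      rw [h, eliasStep]
      by_cases he : Emits n t L p
      · rw [if_pos he, if_pos he, carryEmission_act (label_lt (by omega) ht hu (by omega)),
          stages_carry ht hu k (L + 1) (n + 1) (by omega) (by omega) (by omega), List.append_assoc]
        rfl
      · rw [if_neg he, if_neg he, carryEmission_act_of_ne (by norm_num),
          stages_done ht hu w k (L + 1) (by omega) (by omega), List.append_nil]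

theorem schurEliasProtocol_interleaves : schurEliasProtocol.InterleavesSchurElias := by
  refine ⟨fun x => label 0 x.1 x.2.1 x.2.2, ?_, rfl, ?_⟩
  · rintro ⟨t, u, l⟩ ⟨t', u', l'⟩ h
    simp only [label_inj] at h
    simp [h]
  · intro n t u l ht hu hl b w
    have hln := le_of_testBit_youngDim hl
    rw [schurEliasProtocol_step, LinearMap.comp_apply, LinearMap.comp_apply, read,
      Finsupp.linearCombination_single, one_smul,
      (exists_cgGate n).choose_spec t u l b w ht hu hln, map_sum]
    refine Finset.sum_congr rfl fun p _ => ?_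
    have h1 := Bool.toNat_le p
    have h2 := Bool.toNat_le b
    have hs : SourceBit n (t + p.toNat) l p := by
      rw [SourceBit]
      cases p <;> simpa [youngDimPred] using hl
    rw [map_smul, stages_init (by omega) (by simp only [cgTarget]; omega) hln hs w (n + 2) 0
      (by omega) (by omega), Finsupp.smul_single, smul_eq_mul, mul_one]

end Concentration

open Concentration in
theorem theorem1 :
    ∃ P : StreamingProtocol,
      P.IsReversible ∧
      P.InterleavesSchurElias ∧
      (fun N : ℕ => (P.memoryQubits N : ℝ)) =O[atTop] (fun N : ℕ => Real.log N) ∧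
      ∃ C : ℝ, ∀ ψ : TwoQubit, ‖ψ‖ = 1 →
        (∀ N : ℕ,
          HoldsPerfectEPR (P.jointState ψ N) ∧
          N * entanglement ψ - C * Real.log (N + 1) ≤ expectedYield (P.jointState ψ N) ∧
          expectedYield (P.jointState ψ N) ≤ N * entanglement ψ) ∧
        ∃ K : ℝ, ∀ N : ℕ, ∃ k : ℕ,
          (k : ℝ) ≤ K * Real.log (N + 1) ∧
          N * entanglement ψ ≤ expectedYield (P.jointState ψ (N + k)) := by
  have h := schurEliasProtocol_interleaves
  obtain ⟨hrev, hperf⟩ := h.performance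
  exact ⟨schurEliasProtocol, hrev, h, schurEliasQubits_isBigO, hperf⟩
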